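/- Let $p(x,y)$, $x,y\in\mathbb Z$, be a transition probability matrix ($p\ge 0$, $\sum_y p(x,y)=1$) with $p(x,y)=p(0,y-x)$ and $\sum_x |x|\,p(0,x)<\infty$. Let $\mathcal N=(N_t(x,y))_{t\ge 0}$, $x,y\in\mathbb Z$, be independent Poisson processes on a probability space $(\Omega,\mathcal A,\mathbb P)$, the one indexed by $(x,y)$ having rate $p(x,y)$. Let $\mathcal X=\{0,1\}^{\mathbb Z}$. For $\eta\in\mathcal X$ let $\eta_t^{\eta}(\mathcal N)$ be the exclusion process started from $\eta$ and driven by $\mathcal N$: at each jump time of $N(x,y)$, if $x$ is occupied and $y$ is vacant, the particle at $x$ moves to $y$, and otherwise nothing changes. (Almost surely, for every $z\in\mathbb Z$ and $t\ge0$ there are integers $i\le z<j$ such that up to time $t$ no $N(x,y)$ with $x<i\le y$, $y<i\le x$, $x<j\le y$ or $y<j\le x$ jumps; the value at $z$ at time $t$ is then obtained by carrying out in order of time the finitely many jump attempts inside $[i,j-1]$.) The coupled process started from $(\sigma,\theta)\in\mathcal X^2$ is $(\sigma_t,\theta_t)=(\eta_t^{\sigma}(\mathcal N),\eta_t^{\theta}(\mathcal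 N))$. A probability measure $\mu$ on $\mathcal X^2$ is invariant for it if, when $(\sigma,\theta)$ has law $\mu$ and is independent of $\mathcal N$, $(\sigma_t,\theta_t)$ has law $\mu$ for every $t\ge 0$. For $\lambda,\rho\in[0,1]$ let $\overline\nu^{\lambda,\rho}$ be the law of $(\sigma,\theta)$ where $\sigma(x)=\mathbf 1\{U_x\le\rho\}$, $\theta(x)=\mathbf 1\{U_x\le\lambda\}$ and $(U_x)_{x\in\mathbb Z}$ are i.i.d. uniform on $[0,1]$. **Lemma 2.1.** For all $\lambda,\rho\in[0,1]$ the process $(\sigma_t,\theta_t)$ has an invariant probability measure $\overline\mu^{\lambda,\rho}$ on $\mathcal X^2$ such that, for every finite $A\subset\mathbb Z$, $$\overline\mu^{\lambda,\rho}\{(\sigma,\theta):\sigma(x)=1,\ x\in A\}=\rho^{|A|},\qquad \overline\mu^{\lambda,\rho}\{(\sigma,\theta):\theta(x)=1,\ x\in A\}=\lambda^{|A|}.$$ For this measure, if $\rho<\lambda$, then $\overline\mu^{\lambda,\rho}\{(\sigma,\theta):\sigma\le\theta\text{ coordinatewise}\}=1$. Furthermore, there is a measure $\overline{\overline\nu}$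 on $\mathcal X^2\times\mathcal X^2$ with marginals $\overline\mu^{\lambda,\rho}$ and $\overline\nu^{\lambda,\rho}$ such that $$\overline{\overline\nu}\{((\sigma,\theta),(\widetilde\sigma,\widetilde\theta)):\sigma=\widetilde\sigma\}=1.$$ -/

import Mathlib

open MeasureTheory ProbabilityTheory Set
open scoped NNReal ENNReal

namespace Exclusion

/-- Configurations in `{0,1}^ℤ` (`true` = occupied, `false` = vacant), with the product
σ-algebra and the coordinatewise order `false ≤ true`. -/
abbrev Config : Type := ℤ → Bool

/-! ### Poisson processes -/

/-- `N` is a Poisson process of rate `r` under `P`: a counting process with nondecreasing,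
right-continuous paths started at `0`, whose increments are independent and such that the increment
over `(s, t]` is Poisson with mean `(t - s) * r`. -/
structure IsPoissonProcess {Ω : Type*} [MeasurableSpace Ω] (P : Measure Ω) (r : ℝ≥0)
    (N : ℝ≥0 → Ω → ℕ) : Prop where
  measurable : ∀ t, Measurable (N t)
  zero : ∀ ω, N 0 ω = 0
  mono : ∀ ω, Monotone fun t => N t ω
  rightCont : ∀ ω t, ContinuousWithinAt (fun s => N s ω) (Ici t) t
  indep : HasIndepIncrements N P
  law : ∀ s t, s ≤ t → P.map (fun ω => N t ω - N s ω) = poissonMeasure ((t - s) * r)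

/-- `N x y`, for `x y : ℤ`, are independent Poisson processes, the one indexed by `(x, y)` having
rate `p x y`. -/
structure IsPoissonFamily {Ω : Type*} [MeasurableSpace Ω] (P : Measure Ω) (p : ℤ → ℤ → ℝ≥0)
    (N : ℤ → ℤ → ℝ≥0 → Ω → ℕ) : Prop where
  poisson : ∀ x y, IsPoissonProcess P (p x y) (N x y)
  indep : iIndepFun (fun (e : ℤ × ℤ) (ω : Ω) (t : ℝ≥0) => N e.1 e.2 t ω) P

/-! ### Graphical construction, for fixed counting paths `n x y : ℝ≥0 → ℕ` -/

/-- The counting path `c` jumps at time `s > 0`. -/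
def JumpsAt (c : ℝ≥0 → ℕ) (s : ℝ≥0) : Prop :=
  0 < s ∧ ∀ r < s, c r < c s

/-- The effect of a jump attempt from `x` to `y`: if `x` is occupied and `y` is vacant, then the
particle at `x` moves to `y`; otherwise nothing happens. -/
def attempt (x y : ℤ) (η : Config) : Config :=
  if η x = true ∧ η y = false then Function.update (Function.update η x false) y true else η

/-- The jump attempts `(s, x, y)` that take place in the time interval `(0, t]` between two sites
of the window `[i, j - 1]`. Triples are ordered lexicographically, so by time first. -/
def marks (n : ℤ → ℤ → ℝ≥0 → ℕ) (i j : ℤ) (t : ℝ≥0) : Set (ℝ≥0 ×ₗ (ℤ ×ₗ ℤ)) :=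
  {e | ∃ (s : ℝ≥0) (x y : ℤ), e = toLex (s, toLex (x, y)) ∧ s ≤ t ∧
    x ∈ Ico i j ∧ y ∈ Ico i j ∧ JumpsAt (n x y) s}

/-- A nondecreasing counting path has finitely many jumps in a bounded time interval. -/
theorem finite_jumpsAt {c : ℝ≥0 → ℕ} (hc : Monotone c) (t : ℝ≥0) :
    {s | s ≤ t ∧ JumpsAt c s}.Finite := by
  refine Set.Finite.of_finite_image (f := c) ((Set.finite_Iic (c t)).subset ?_) ?_
  · rintro _ ⟨s, ⟨hs, -⟩, rfl⟩
    exact hc hs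
  · rintro a ⟨-, ha⟩ b ⟨-, hb⟩ hab
    rcases lt_trichotomy a b with h | h | h
    · exact absurd hab (hb.2 a h).ne
    · exact h
    · exact absurd hab.symm (ha.2 b h).ne

/-- There are finitely many jump attempts within a bounded window in a bounded time. -/
theorem finite_marks {n : ℤ → ℤ → ℝ≥0 → ℕ} (hn : ∀ x y, Monotone (n x y)) (i j : ℤ) (t : ℝ≥0) :
    (marks n i j t).Finite := by
  have h : (⋃ x ∈ Ico i j, ⋃ y ∈ Ico i j,
      (fun s : ℝ≥0 => (toLex (s, toLex (x, y)) : ℝ≥0 ×ₗ (ℤ ×ₗ ℤ))) ''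
        {s | s ≤ t ∧ JumpsAt (n x y) s}).Finite :=
    (Set.finite_Ico i j).biUnion fun x _ => (Set.finite_Ico i j).biUnion fun y _ =>
      (finite_jumpsAt (hn x y) t).image _
  refine h.subset ?_
  rintro _ ⟨s, x, y, rfl, hs, hx, hy, hj⟩
  simp only [mem_iUnion]
  exact ⟨x, hx, y, hy, s, ⟨hs, hj⟩, rfl⟩

open Classical in
/-- The jump attempts within the window `[i, j - 1]` during `(0, t]`, listed in order of time
(simultaneous attempts, which have probability zero, are listed lexicographically). By
`finite_marks` the second branch is never taken for counting paths. -/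
noncomputable def markList (n : ℤ → ℤ → ℝ≥0 → ℕ) (i j : ℤ) (t : ℝ≥0) :
    List (ℝ≥0 ×ₗ (ℤ ×ₗ ℤ)) :=
  if h : (marks n i j t).Finite then h.toFinset.sort (· ≤ ·) else []

/-- The configuration at time `t` of the finite system in the window `[i, j - 1]`, started from `η`:
the jump attempts within the window are carried out one after the other. -/
noncomputable def windowEvolve (n : ℤ → ℤ → ℝ≥0 → ℕ) (i j : ℤ) (t : ℝ≥0) (η : Config) : Config :=
  (markList n i j t).foldl
    (fun ζ e => attempt (ofLex (ofLex e).2).1 (ofLex (ofLex e).2).2 ζ) η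

/-- Up to time `t` there is no jump attempt across `i`, that is, between a site `x < i` and a
site `y ≥ i`, in either direction. -/
def NoCrossing (n : ℤ → ℤ → ℝ≥0 → ℕ) (i : ℤ) (t : ℝ≥0) : Prop :=
  ∀ x y : ℤ, x < i → i ≤ y → n x y t = 0 ∧ n y x t = 0

open Classical in
/-- The configuration `η_t` of the exclusion process started from `η` and driven by the paths `n`.
The site `z` is occupied at time `t` if, for some window `[i, j - 1]` containing `z` whose two
boundaries are not crossed up to time `t`, it is occupied in the finite system in that window.
(All such windows give the same answer. Almost surely under a Poisson family one exists for
all `z` and `t`; if there is none, `z` is declared vacant.) -/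
noncomputable def evolve (n : ℤ → ℤ → ℝ≥0 → ℕ) (t : ℝ≥0) (η : Config) : Config := fun z =>
  decide (∃ i j : ℤ, i ≤ z ∧ z < j ∧ NoCrossing n i t ∧ NoCrossing n j t ∧
    windowEvolve n i j t η z = true)

/-! ### The coupled process and its invariant measures -/

/-- The coupled process `(σ_t, θ_t)`: both components are driven by the same Poisson processes. -/
noncomputable def coupled {Ω : Type*} (N : ℤ → ℤ → ℝ≥0 → Ω → ℕ) (t : ℝ≥0)
    (ζ : Config × Config) (ω : Ω) : Config × Config :=
  (evolve (fun x y s => N x y s ω) t ζ.1, evolve (fun x y s => N x y s ω) t ζ.2)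

/-- `μ` is invariant for the coupled process: if `(σ_0, θ_0)` has law `μ` and is independent of the
Poisson processes, then `(σ_t, θ_t)` has law `μ` for every `t ≥ 0`. -/
def IsInvariant {Ω : Type*} [MeasurableSpace Ω] (P : Measure Ω) (N : ℤ → ℤ → ℝ≥0 → Ω → ℕ)
    (μ : Measure (Config × Config)) : Prop :=
  ∀ t : ℝ≥0, HasLaw (fun q : (Config × Config) × Ω => coupled N t q.1 q.2) μ (μ.prod P)

/-- The product measure `ν̄^{λ,ρ}` on pairs of configurations: the law of `(σ, θ)`, where
`σ x = 1{U x ≤ ρ}`, `θ x = 1{U x ≤ λ}` and `U x`, `x : ℤ`, are i.i.d. uniform on `[0,1]`. -/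
noncomputable def nuBar (lam rho : ℝ) : Measure (Config × Config) :=
  (Measure.infinitePi fun _ : ℤ => (volume : Measure unitInterval)).map
    fun U => (fun x => decide ((U x : ℝ) ≤ rho), fun x => decide ((U x : ℝ) ≤ lam))

end Exclusion

/-!
The invariant measure is found by compactness inside the set of couplings of the two Bernoulli
product measures, and it is glued to `ν̄` along their common first marginal.

*Finite systems.* Carrying out finitely many independent Poisson jump attempts gives a random map
of the configuration space. On a fine enough grid in `(0, t]` the jumps can be read off, in order,
from the independent increments of the Poisson processes (`eventually_gridList_eq`), so Chernoff's
product formula (`tendsto_pow_exp`) identifies the expectation operator as `exp (t • L)`, where `L`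
is the finite sum of the generators of the single attempts (`integral_finFlow`).

*Infinite volume.* By the moment assumption the total rate of the jump attempts across a given
bond is finite. By translation invariance the probability that a bond is not crossed up to time
`t` is positive and the same for all bonds, and a `0`-`1` law gives uncrossed bonds arbitrarily far
to the left and to the right of any site (`ae_exists_noCrossing`). Hence every sequence of finite
systems that agrees with the exclusion process in each fixed window from some point on converges
almost surely to it, locally uniformly in the initial configuration (`tendsto_finFlow_evolve`).
This is used twice. With growing windows it shows that the transition operators `transOp` of the
coupled process are Feller and form a semigroup (`transOp_add`), as limits of exponential
semigroups. With growing tori it shows that Bernoulli product measures are invariant for the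
exclusion process (`integral_evolve_bernoulliProduct`): on a torus the rates in and out of each
site balance, so that the generator integrates to zero.

*The invariant coupling.* The couplings of the Bernoulli product measures with densities `ρ` and
`λ`, supported on ordered pairs when `ρ < λ`, form a closed convex set of probability measures
which contains `ν̄`. The coupled process preserves it: the marginals are invariant, and both
components carry out the same attempts, each of which is monotone (`monotone_evolve`). By the
Markov–Kakutani argument `exists_common_invariant` the commuting transition operators have a common
invariant measure there. It has the same first marginal as `ν̄`, so drawing the two second
components conditionally independently given `σ` produces the joint measure
(`exists_glued_measure`).
-/

/-! ### Lists of jumps of counting paths -/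

namespace Exclusion

open Filter Topology

section JumpList

theorem sort_eq_of_pairwise_lt {α : Type*} [LinearOrder α] (s : Finset α) (l : List α)
    (hm : ∀ x, x ∈ l ↔ x ∈ s) (hl : l.Pairwise (· < ·)) : s.sort (· ≤ ·) = l := by
  have hs : s = l.toFinset := by ext x; simp [hm]
  rw [hs]
  exact (List.toFinset_sort _ (hl.imp fun h => h.ne)).2 (hl.imp fun h => h.le)

variable {ι : Type*}

/-- The jumps `(s, e)` with `e ∈ K` and `a < s ≤ b` of a family of counting paths, ordered by
time first. -/
def jumpMarks (c : ι → ℝ≥0 → ℕ) (K : Finset ι) (a b : ℝ≥0) : Set (ℝ≥0 ×ₗ ι) :=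
  {e | (ofLex e).2 ∈ K ∧ a < (ofLex e).1 ∧ (ofLex e).1 ≤ b ∧
    JumpsAt (c (ofLex e).2) (ofLex e).1}

theorem finite_jumpMarks {c : ι → ℝ≥0 → ℕ} (hc : ∀ e, Monotone (c e)) (K : Finset ι)
    (a b : ℝ≥0) : (jumpMarks c K a b).Finite := by
  have h : (⋃ e ∈ K, (fun s : ℝ≥0 => (toLex (s, e) : ℝ≥0 ×ₗ ι)) ''
      {s | s ≤ b ∧ JumpsAt (c e) s}).Finite :=
    K.finite_toSet.biUnion fun e _ => (finite_jumpsAt (hc e) b).image _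
  refine h.subset ?_
  rintro e ⟨hK, -, hb, hj⟩
  simp only [mem_iUnion]
  exact ⟨_, hK, _, ⟨hb, hj⟩, rfl⟩

variable [LinearOrder ι]

open Classical in
/-- The indices of the jumps in `jumpMarks c K a b`, listed in order of time (simultaneous jumps
in the order of their indices). -/
noncomputable def jumpList (c : ι → ℝ≥0 → ℕ) (K : Finset ι) (a b : ℝ≥0) : List ι :=
  if h : (jumpMarks c K a b).Finite then
    (h.toFinset.sort (· ≤ ·)).map fun e => (ofLex e).2 else []

theorem jumpList_eq_of_pairwise {c : ι → ℝ≥0 → ℕ} (hc : ∀ e, Monotone (c e)) (K : Finset ι)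
    (a b : ℝ≥0) (l : List (ℝ≥0 ×ₗ ι)) (hm : ∀ e, e ∈ l ↔ e ∈ jumpMarks c K a b)
    (hl : l.Pairwise (· < ·)) : jumpList c K a b = l.map fun e => (ofLex e).2 := by
  have h := finite_jumpMarks hc K a b
  rw [jumpList, dif_pos h, sort_eq_of_pairwise_lt h.toFinset l (by simpa using hm) hl]

/-- The sorted list of marks behind `jumpList`. -/
theorem exists_sorted_marks {c : ι → ℝ≥0 → ℕ} (hc : ∀ e, Monotone (c e)) (K : Finset ι)
    (a b : ℝ≥0) : ∃ l : List (ℝ≥0 ×ₗ ι), (∀ e, e ∈ l ↔ e ∈ jumpMarks c K a b) ∧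
      l.Pairwise (· < ·) ∧ jumpList c K a b = l.map fun e => (ofLex e).2 := by
  have h := finite_jumpMarks hc K a b
  refine ⟨h.toFinset.sort (· ≤ ·), by simp, ?_, by rw [jumpList, dif_pos h]⟩
  exact (Finset.sortedLT_sort _).pairwise

theorem mem_jumpList {c : ι → ℝ≥0 → ℕ} (hc : ∀ e, Monotone (c e)) {K : Finset ι}
    {a b : ℝ≥0} {e : ι} :
    e ∈ jumpList c K a b ↔ e ∈ K ∧ ∃ s, a < s ∧ s ≤ b ∧ JumpsAt (c e) s := by
  obtain ⟨l, hl, -, h⟩ := exists_sorted_marks hc K a b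
  rw [h, List.mem_map]
  constructor
  · rintro ⟨x, hx, rfl⟩
    obtain ⟨h1, h2⟩ := (hl x).1 hx
    exact ⟨h1, _, h2⟩
  · rintro ⟨hK, s, hs⟩
    exact ⟨toLex (s, e), (hl _).2 ⟨hK, hs⟩, rfl⟩

theorem jumpList_append {c : ι → ℝ≥0 → ℕ} (hc : ∀ e, Monotone (c e)) (K : Finset ι)
    {a b d : ℝ≥0} (hab : a ≤ b) (hbd : b ≤ d) :
    jumpList c K a d = jumpList c K a b ++ jumpList c K b d := by
  obtain ⟨l, hl, hl', h⟩ := exists_sorted_marks hc K a b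
  obtain ⟨k, hk, hk', h'⟩ := exists_sorted_marks hc K b d
  rw [h, h', ← List.map_append]
  refine jumpList_eq_of_pairwise hc K a d _ (fun e => ?_) ?_
  · simp only [List.mem_append, hl, hk, jumpMarks, mem_ofPred_eq]
    constructor
    · rintro (⟨h1, h2, h3, h4⟩ | ⟨h1, h2, h3, h4⟩)
      · exact ⟨h1, h2, h3.trans hbd, h4⟩
      · exact ⟨h1, hab.trans_lt h2, h3, h4⟩
    · rintro ⟨h1, h2, h3, h4⟩
      rcases le_or_gt (ofLex e).1 b with h5 | h5
      · exact Or.inl ⟨h1, h2, h5, h4⟩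
      · exact Or.inr ⟨h1, h5, h3, h4⟩
  · refine List.pairwise_append.2 ⟨hl', hk', fun x hx y hy => ?_⟩
    have h1 := ((hl x).1 hx).2.2.1
    have h2 := ((hk y).1 hy).2.1
    exact Prod.Lex.lt_iff.2 (Or.inl (h1.trans_lt h2))

theorem jumpList_of_subset {c : ι → ℝ≥0 → ℕ} (hc : ∀ e, Monotone (c e)) {K K' : Finset ι}
    (hK : K' ⊆ K) (a b : ℝ≥0) :
    jumpList c K' a b = (jumpList c K a b).filter fun e => e ∈ K' := by
  obtain ⟨l, hl, hl', h⟩ := exists_sorted_marks hc K a b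
  rw [h, List.filter_map]
  refine jumpList_eq_of_pairwise hc K' a b _ (fun e => ?_) (hl'.filter _)
  simp only [List.mem_filter, hl, jumpMarks, mem_ofPred_eq, Function.comp, decide_eq_true_eq]
  constructor
  · rintro ⟨⟨-, h2⟩, h1⟩
    exact ⟨h1, h2⟩
  · rintro ⟨h1, h2⟩
    exact ⟨⟨hK h1, h2⟩, h1⟩

/-- A right-continuous counting path increases over `(a, b]` exactly when it jumps there. -/
theorem lt_iff_exists_jumpsAt {c : ℝ≥0 → ℕ} (hc : Monotone c)
    (hr : ∀ t, ContinuousWithinAt c (Ici t) t) {a b : ℝ≥0} :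
    c a < c b ↔ ∃ s, a < s ∧ s ≤ b ∧ JumpsAt c s := by
  constructor
  · intro hab
    set S : Set ℝ≥0 := {u | c a < c u} with hS
    have hbdd : BddBelow S := OrderBot.bddBelow S
    have hne : S.Nonempty := ⟨b, hab⟩
    set s := sInf S with hs
    have hsS : c a < c s := by
      have h1 : ∀ᶠ u in 𝓝[≥] s, c u = c s := by
        have := hr s
        rw [ContinuousWithinAt, nhds_discrete, tendsto_pure] at this
        exact this
      obtain ⟨u, hu, hsu⟩ := mem_nhdsGE_iff_exists_Ico_subset.1 h1
      obtain ⟨v, hv, hvu⟩ := exists_lt_of_csInf_lt hne hu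
      have := hsu ⟨csInf_le hbdd hv, hvu⟩
      simp only [mem_ofPred_eq] at this
      rw [← this]
      exact hv
    have has : a < s := by
      by_contra h
      exact absurd (hc (not_lt.1 h)) (not_le.2 hsS)
    refine ⟨s, has, csInf_le hbdd hab, zero_le.trans_lt has, fun r hrs => ?_⟩
    have : r ∉ S := notMem_of_lt_csInf hrs hbdd
    exact (not_lt.1 this).trans_lt hsS
  · rintro ⟨s, has, hsb, -, hj⟩
    exact (hj a has).trans_le (hc hsb)

/-- If all jumps in `(a, b]` are simultaneous, then `jumpList` lists the indices of the paths that
increase over `(a, b]` in their own order. -/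
theorem jumpList_eq_filter_sort {c : ι → ℝ≥0 → ℕ} (hc : ∀ e, Monotone (c e))
    (hr : ∀ e t, ContinuousWithinAt (c e) (Ici t) t) (K : Finset ι) (a b : ℝ≥0)
    (h1 : ∀ x ∈ jumpMarks c K a b, ∀ y ∈ jumpMarks c K a b, (ofLex x).1 = (ofLex y).1) :
    jumpList c K a b = (K.sort (· ≤ ·)).filter fun e => c e a < c e b := by
  obtain ⟨s, hs⟩ : ∃ s, ∀ x ∈ jumpMarks c K a b, (ofLex x).1 = s := by
    by_cases h : (jumpMarks c K a b).Nonempty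
    · obtain ⟨y, hy⟩ := h
      exact ⟨_, fun x hx => h1 x hx y hy⟩
    · exact ⟨0, fun x hx => (h ⟨x, hx⟩).elim⟩
  set L := (K.sort (· ≤ ·)).filter fun e => decide (c e a < c e b) with hL
  have := jumpList_eq_of_pairwise hc K a b (L.map fun e => toLex (s, e)) (fun x => ?_) ?_
  · rw [this, List.map_map]
    exact List.map_id _
  · simp only [List.mem_map, hL, List.mem_filter, Finset.mem_sort, decide_eq_true_eq]
    constructor
    · rintro ⟨e, ⟨hK, he⟩, rfl⟩
      obtain ⟨u, hu⟩ := (lt_iff_exists_jumpsAt (hc e) (hr e)).1 he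
      have hm : toLex (u, e) ∈ jumpMarks c K a b := ⟨hK, hu⟩
      have : u = s := hs _ hm
      rwa [this] at hm
    · intro hx
      refine ⟨(ofLex x).2, ⟨hx.1, (lt_iff_exists_jumpsAt (hc _) (hr _)).2 ⟨_, hx.2⟩⟩, ?_⟩
      rw [← hs x hx]
      rfl
  · refine List.pairwise_map.2 ((((Finset.sortedLT_sort K).pairwise).filter _).imp ?_)
    intro x y hxy
    exact Prod.Lex.lt_iff.2 (Or.inr ⟨rfl, hxy⟩)

theorem jumpList_self (c : ι → ℝ≥0 → ℕ) (K : Finset ι) (a : ℝ≥0) : jumpList c K a a = [] := by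
  have : jumpMarks c K a a = ∅ := by
    ext e
    simp only [jumpMarks, mem_ofPred_eq, mem_empty_iff_false, iff_false]
    rintro ⟨-, h1, h2, -⟩
    exact absurd h2 (not_le.2 h1)
  simp [jumpList, this]

theorem jumpList_eq_flatMap {c : ι → ℝ≥0 → ℕ} (hc : ∀ e, Monotone (c e)) (K : Finset ι)
    {u : ℕ → ℝ≥0} (hu : Monotone u) (m : ℕ) :
    jumpList c K (u 0) (u m) = (List.range m).flatMap fun k => jumpList c K (u k) (u (k + 1)) := by
  induction m with
  | zero => simp [jumpList_self]
  | succ m ih =>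
    rw [List.range_succ, List.flatMap_append, ← ih,
      jumpList_append hc K (hu (Nat.zero_le m)) (hu (Nat.le_succ m))]
    simp

/-- The indices of the paths in `K` that increase over the intervals
`(k t / m, (k + 1) t / m]`, `k < m`, listed interval by interval. -/
noncomputable def gridList (c : ι → ℝ≥0 → ℕ) (K : Finset ι) (t : ℝ≥0) (m : ℕ) : List ι :=
  (List.range m).flatMap fun k : ℕ =>
    (K.sort (· ≤ ·)).filter fun e => c e ((k : ℝ≥0) * (t / m)) < c e (((k + 1 : ℕ) : ℝ≥0) * (t / m))

/-- On a fine enough grid, the jumps in order of time can be read off from the increments. -/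
theorem eventually_gridList_eq {c : ι → ℝ≥0 → ℕ} (hc : ∀ e, Monotone (c e))
    (hr : ∀ e t, ContinuousWithinAt (c e) (Ici t) t) (K : Finset ι) (t : ℝ≥0) :
    ∀ᶠ m : ℕ in atTop, gridList c K t m = jumpList c K 0 t := by
  set T : Set ℝ≥0 := (fun x => (ofLex x).1) '' jumpMarks c K 0 t with hT
  have hTfin : T.Finite := (finite_jumpMarks hc K 0 t).image _
  -- eventually the mesh is smaller than all gaps between distinct jump times
  have hgap : ∀ᶠ m : ℕ in atTop, ∀ s ∈ T, ∀ s' ∈ T, s < s' → t / m < s' - s := by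
    refine (hTfin.eventually_all).2 fun s _ => (hTfin.eventually_all).2 fun s' _ => ?_
    by_cases h : s < s'
    · have h0 : Tendsto (fun m : ℕ => t / (m : ℝ≥0)) atTop (𝓝 0) :=
        tendsto_const_div_atTop_nhds_zero_nat t
      filter_upwards [h0.eventually_lt_const (tsub_pos_of_lt h)] with m hm _ using hm
    · exact Eventually.of_forall fun m h' => (h h').elim
  filter_upwards [hgap, eventually_gt_atTop 0] with m hm hm0
  have hm0' : (m : ℝ≥0) ≠ 0 := by exact_mod_cast hm0.ne'
  set u : ℕ → ℝ≥0 := fun k => k * (t / m) with hu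
  have humono : Monotone u := fun i j hij => by
    simp only [hu]; gcongr
  have h0 : u 0 = 0 := by simp [hu]
  have hmt : u m = t := by simp only [hu]; field_simp
  have key := jumpList_eq_flatMap hc K humono m
  rw [h0, hmt] at key
  rw [key, gridList]
  refine List.flatMap_congr fun k hk => ?_
  have hkm : k < m := List.mem_range.1 hk
  rw [jumpList_eq_filter_sort hc hr]
  have aux : ∀ x ∈ jumpMarks c K (u k) (u (k + 1)), ∀ y ∈ jumpMarks c K (u k) (u (k + 1)),
      ¬ (ofLex x).1 < (ofLex y).1 := by
    intro x hx y hy hxy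
    have mem : ∀ z ∈ jumpMarks c K (u k) (u (k + 1)), (ofLex z).1 ∈ T := fun z hz =>
      ⟨z, ⟨hz.1, zero_le.trans_lt hz.2.1, hz.2.2.1.trans (hmt ▸ humono hkm), hz.2.2.2⟩, rfl⟩
    have h3 := hm _ (mem x hx) _ (mem y hy) hxy
    have h4 : (ofLex y).1 ≤ u k + t / m := by
      have := hy.2.2.1
      simp only [hu] at this ⊢
      push_cast at this
      linarith
    have h5 : (ofLex y).1 - (ofLex x).1 ≤ t / m := by
      rw [tsub_le_iff_right]
      calc (ofLex y).1 ≤ u k + t / m := h4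
        _ ≤ t / m + (ofLex x).1 := by rw [add_comm]; gcongr; exact hx.2.1.le
    exact absurd h3 (not_lt.2 h5)
  intro x hx y hy
  exact le_antisymm (not_lt.1 (aux y hy x hx)) (not_lt.1 (aux x hx y hy))

end JumpList

/-- The ordered pairs of sites of the window `[i, j - 1]`. -/
noncomputable def windowEdges (i j : ℤ) : Finset (ℤ ×ₗ ℤ) :=
  ((Finset.Ico i j) ×ˢ (Finset.Ico i j)).map toLex.toEmbedding

theorem mem_windowEdges {i j : ℤ} {e : ℤ ×ₗ ℤ} :
    e ∈ windowEdges i j ↔ (ofLex e).1 ∈ Ico i j ∧ (ofLex e).2 ∈ Ico i j := by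
  simp only [windowEdges, Finset.mem_map_equiv, Finset.mem_product, Finset.mem_Ico, mem_Ico]
  rfl

/-- The paths `n x y`, indexed by the lexicographically ordered pairs `(x, y)`. -/
def edgePaths (n : ℤ → ℤ → ℝ≥0 → ℕ) (e : ℤ ×ₗ ℤ) : ℝ≥0 → ℕ := n (ofLex e).1 (ofLex e).2

theorem windowEvolve_eq {n : ℤ → ℤ → ℝ≥0 → ℕ} (i j : ℤ)
    (t : ℝ≥0) (η : Config) :
    windowEvolve n i j t η = (jumpList (edgePaths n) (windowEdges i j) 0 t).foldl
      (fun ζ e => attempt (ofLex e).1 (ofLex e).2 ζ) η := by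
  have hm : marks n i j t = jumpMarks (edgePaths n) (windowEdges i j) 0 t := by
    ext e
    constructor
    · rintro ⟨s, x, y, rfl, hs, hx, hy, hj⟩
      exact ⟨mem_windowEdges.2 ⟨hx, hy⟩, hj.1, hs, hj⟩
    · rintro ⟨hK, h0, hs, hj⟩
      exact ⟨_, _, _, rfl, hs, (mem_windowEdges.1 hK).1, (mem_windowEdges.1 hK).2, hj⟩
  by_cases h : (jumpMarks (edgePaths n) (windowEdges i j) 0 t).Finite
  · have h' : (marks n i j t).Finite := hm ▸ h
    have hs : h'.toFinset = h.toFinset := by ext; simp [hm]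
    rw [windowEvolve, markList, dif_pos h', jumpList, dif_pos h, List.foldl_map, hs]
  · have h' : ¬ (marks n i j t).Finite := hm ▸ h
    rw [windowEvolve, markList, dif_neg h', jumpList, dif_neg h]
    rfl

end Exclusion

/-! ### Semigroups of finite systems as operator exponentials -/

namespace Exclusion

open Filter Topology BoundedContinuousFunction

section Chernoff

theorem norm_pow_sub_pow_le {A : Type*} [NormedRing A] {x y : A} {C : ℝ}
    (hx : ‖x‖ ≤ 1) (m : ℕ) (hy : ∀ k ≤ m, ‖y ^ k‖ ≤ C) :
    ‖x ^ m - y ^ m‖ ≤ m * ‖x - y‖ * C := by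
  induction m with
  | zero => simp
  | succ m ih =>
    have h1 : x ^ (m + 1) - y ^ (m + 1) = x * (x ^ m - y ^ m) + (x - y) * y ^ m := by
      rw [pow_succ', pow_succ' y, mul_sub, sub_mul]; abel
    have h2 := ih fun k hk => hy k (hk.trans m.le_succ)
    rw [h1]
    calc ‖x * (x ^ m - y ^ m) + (x - y) * y ^ m‖
        ≤ ‖x‖ * ‖x ^ m - y ^ m‖ + ‖x - y‖ * ‖y ^ m‖ :=
          (norm_add_le _ _).trans (add_le_add (norm_mul_le _ _) (norm_mul_le _ _))
      _ ≤ 1 * (m * ‖x - y‖ * C) + ‖x - y‖ * C := by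
          gcongr
          exact hy m m.le_succ
      _ = ((m + 1 : ℕ) : ℝ) * ‖x - y‖ * C := by push_cast; ring

theorem exp_smul_pow {A : Type*} [NormedRing A] [NormedAlgebra ℝ A] [CompleteSpace A] (L : A)
    (h : ℝ) (k : ℕ) : NormedSpace.exp (h • L) ^ k = NormedSpace.exp ((k * h) • L) := by
  let _ : NormedAlgebra ℚ A := NormedAlgebra.restrictScalars ℚ ℝ A
  rw [← NormedSpace.exp_nsmul, mul_smul, Nat.cast_smul_eq_nsmul]

theorem exp_add_smul {A : Type*} [NormedRing A] [NormedAlgebra ℝ A] [CompleteSpace A] (L : A)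
    (s t : ℝ) : NormedSpace.exp ((s + t) • L) =
      NormedSpace.exp (s • L) * NormedSpace.exp (t • L) := by
  let _ : NormedAlgebra ℚ A := NormedAlgebra.restrictScalars ℚ ℝ A
  rw [add_smul, NormedSpace.exp_add_of_commute]
  exact ((Commute.refl L).smul_left s).smul_right t

/-- Chernoff's product formula, in norm: contractions `F h` with `F h = 1 + h L + o(h)` satisfy
`F (t / m) ^ m → exp (t L)`. -/
theorem tendsto_pow_exp {A : Type*} [NormedRing A] [NormedAlgebra ℝ A]
    [CompleteSpace A] {F : ℝ → A} {L : A} (hF0 : F 0 = 1) (hF1 : ∀ h, 0 ≤ h → ‖F h‖ ≤ 1)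
    (hF : HasDerivAt F L 0) {t : ℝ} (ht : 0 ≤ t) :
    Tendsto (fun m : ℕ => F (t / m) ^ m) atTop (𝓝 (NormedSpace.exp (t • L))) := by
  have hE : HasDerivAt (fun u : ℝ => NormedSpace.exp (u • L)) L 0 := by
    simpa using hasDerivAt_exp_smul_const L (0 : ℝ)
  obtain ⟨C, hC⟩ := (isCompact_Icc (a := (0 : ℝ)) (b := t)).exists_bound_of_continuousOn
    (f := fun u : ℝ => NormedSpace.exp (u • L))
    (fun u _ => (hasDerivAt_exp_smul_const L u).continuousAt.continuousWithinAt)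
  have hC0 : 0 ≤ C := (norm_nonneg _).trans (hC 0 ⟨le_rfl, ht⟩)
  -- `F` and `exp (· L)` agree to first order at `0`
  have hD : HasDerivAt (fun u : ℝ => F u - NormedSpace.exp (u • L)) 0 0 := by
    have := hF.sub hE
    rw [sub_self] at this
    exact this
  rw [hasDerivAt_iff_isLittleO_nhds_zero] at hD
  simp only [zero_add, zero_smul, NormedSpace.exp_zero, hF0, sub_self, sub_zero, smul_zero] at hD
  have h0 : Tendsto (fun m : ℕ => t / (m : ℝ)) atTop (𝓝 0) :=
      tendsto_const_div_atTop_nhds_zero_nat t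
  rw [tendsto_iff_norm_sub_tendsto_zero, Metric.tendsto_atTop']
  intro ε hε
  have hε' : 0 < ε / (2 * ((t + 1) * (C + 1))) := by positivity
  have hev := h0.eventually (hD.bound hε')
  obtain ⟨M, hM⟩ := (hev.and (eventually_gt_atTop 0)).exists_forall_of_atTop
  refine ⟨M, fun m hm => ?_⟩
  obtain ⟨h1, hm0⟩ := hM m hm.le
  have hm0' : (0 : ℝ) < m := by exact_mod_cast hm0
  have hth : 0 ≤ t / m := by positivity
  have h2 := norm_pow_sub_pow_le (y := NormedSpace.exp ((t / m) • L)) (C := C)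
    (hF1 (t / m) hth) m (fun k hk => by
      rw [exp_smul_pow]
      refine hC _ ⟨by positivity, ?_⟩
      have : (k : ℝ) ≤ m := by exact_mod_cast hk
      calc (k : ℝ) * (t / m) ≤ m * (t / m) := by gcongr
        _ = t := by field_simp)
  rw [exp_smul_pow, show (m : ℝ) * (t / m) = t by field_simp] at h2
  rw [Real.dist_eq, sub_zero, abs_norm]
  refine h2.trans_lt ?_
  rw [Real.norm_of_nonneg hth] at h1
  calc (m : ℝ) * ‖F (t / m) - NormedSpace.exp ((t / m) • L)‖ * C
      ≤ m * (ε / (2 * ((t + 1) * (C + 1))) * (t / m)) * C := by gcongr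
    _ = ε / 2 * (t / (t + 1)) * (C / (C + 1)) := by field_simp
    _ ≤ ε / 2 * 1 * 1 := by
        gcongr
        · exact div_le_one_of_le₀ (by linarith) (by linarith)
        · exact div_le_one_of_le₀ (by linarith) (by linarith)
    _ < ε := by linarith

end Chernoff

section Koopman

/-- Bounded operators on a real normed space. The abbreviation makes the module structure of a
space of functions come from its norm. -/
abbrev BoundedOp (E : Type*) [NormedAddCommGroup E] [NormedSpace ℝ E] : Type _ := E →L[ℝ] E

variable {Y : Type*} [TopologicalSpace Y]

/-- The Koopman operator `f ↦ f ∘ a` of a continuous map `a`, on continuous functions. -/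
noncomputable def koopman (a : C(Y, Y)) : BoundedOp (Y →ᵇ ℝ) :=
  LinearMap.mkContinuous
    { toFun := fun f => f.compContinuous a
      map_add' := fun _ _ => rfl
      map_smul' := fun _ _ => rfl } 1
    (fun f => by
      rw [one_mul]
      exact (BoundedContinuousFunction.norm_le (norm_nonneg f)).2 fun y => f.norm_coe_le_norm (a y))

@[simp] theorem koopman_apply (a : C(Y, Y)) (f : Y →ᵇ ℝ) (y : Y) :
    koopman a f y = f (a y) := rfl

/-- The expectation operator of the random map that is `a` with probability `q` and the identity
with probability `1 - q`. -/
noncomputable def lazyOp (a : C(Y, Y)) (q : ℝ) : BoundedOp (Y →ᵇ ℝ) :=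
  1 + q • (koopman a - 1)

theorem lazyOp_apply (a : C(Y, Y)) (q : ℝ) (f : Y →ᵇ ℝ) (y : Y) :
    lazyOp a q f y = q * f (a y) + (1 - q) * f y := by
  simp [lazyOp]; ring

theorem norm_lazyOp_le (a : C(Y, Y)) {q : ℝ} (h0 : 0 ≤ q) (h1 : q ≤ 1) : ‖lazyOp a q‖ ≤ 1 := by
  refine ContinuousLinearMap.opNorm_le_bound _ zero_le_one fun f => ?_
  rw [one_mul]
  refine (BoundedContinuousFunction.norm_le (norm_nonneg f)).2 fun y => ?_
  rw [lazyOp_apply]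
  have h2 : (0 : ℝ) ≤ 1 - q := by linarith
  calc ‖q * f (a y) + (1 - q) * f y‖ ≤ ‖q * f (a y)‖ + ‖(1 - q) * f y‖ := norm_add_le _ _
    _ = q * ‖f (a y)‖ + (1 - q) * ‖f y‖ := by
        rw [norm_mul, norm_mul, Real.norm_of_nonneg h0, Real.norm_of_nonneg h2]
    _ ≤ q * ‖f‖ + (1 - q) * ‖f‖ := by
        gcongr
        · exact f.norm_coe_le_norm _
        · exact f.norm_coe_le_norm _
    _ = ‖f‖ := by ring

variable {ι : Type*}

theorem norm_list_prod_le_one {A : Type*} [NormedRing A] (h1 : ‖(1 : A)‖ ≤ 1)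
    (l : List A) (h : ∀ x ∈ l, ‖x‖ ≤ 1) : ‖l.prod‖ ≤ 1 := by
  induction l with
  | nil => simpa using h1
  | cons x l ih =>
    rw [List.prod_cons]
    have h1 := h x (by simp)
    have h2 := ih fun y hy => h y (by simp [hy])
    exact (norm_mul_le _ _).trans (mul_le_one₀ h1 (norm_nonneg _) h2)

/-- The expectation operator of one step of mesh `h`: in the order of the list, each map `a e` is
applied with probability `1 - exp (-h r e)`. -/
noncomputable def stepOp (a : ι → C(Y, Y)) (r : ι → ℝ≥0) (l : List ι) (h : ℝ) :
    BoundedOp (Y →ᵇ ℝ) :=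
  (l.map fun e => lazyOp (a e) (1 - Real.exp (-(h * r e)))).prod

theorem norm_stepOp_le (a : ι → C(Y, Y)) (r : ι → ℝ≥0) (l : List ι) {h : ℝ}
    (hh : 0 ≤ h) : ‖stepOp a r l h‖ ≤ 1 := by
  refine norm_list_prod_le_one ContinuousLinearMap.norm_id_le _ fun x hx => ?_
  obtain ⟨e, -, rfl⟩ := List.mem_map.1 hx
  refine norm_lazyOp_le _ ?_ ?_
  · have : Real.exp (-(h * r e)) ≤ 1 := Real.exp_le_one_iff.2 (by
      have : 0 ≤ h * (r e : ℝ) := by positivity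
      linarith)
    linarith
  · linarith [Real.exp_pos (-(h * r e))]

theorem stepOp_zero (a : ι → C(Y, Y)) (r : ι → ℝ≥0) (l : List ι) : stepOp a r l 0 = 1 := by
  refine List.prod_eq_one fun x hx => ?_
  obtain ⟨e, -, rfl⟩ := List.mem_map.1 hx
  simp [lazyOp]

theorem hasDerivAt_stepOp (a : ι → C(Y, Y)) (r : ι → ℝ≥0) (l : List ι) :
    HasDerivAt (stepOp a r l) (l.map fun e => (r e : ℝ) • (koopman (a e) - 1)).sum 0 := by
  induction l with
  | nil => exact hasDerivAt_const (0 : ℝ) (1 : BoundedOp (Y →ᵇ ℝ))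
  | cons e l ih =>
    have h1 : HasDerivAt (fun h : ℝ => 1 - Real.exp (-(h * r e))) (r e : ℝ) 0 := by
      have := (((hasDerivAt_id (0 : ℝ)).mul_const (r e : ℝ)).neg.exp).const_sub 1
      simpa using this
    have h2 : HasDerivAt (fun h : ℝ => lazyOp (a e) (1 - Real.exp (-(h * r e))))
        ((r e : ℝ) • (koopman (a e) - 1)) 0 :=
      (h1.smul_const (koopman (a e) - 1)).const_add 1
    have h3 := h2.mul ih
    have h4 : lazyOp (a e) (1 - Real.exp (-((0 : ℝ) * r e))) = 1 := by simp [lazyOp]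
    rw [h4, stepOp_zero, mul_one, one_mul] at h3
    have h5 : stepOp a r (e :: l) =
        (fun h : ℝ => lazyOp (a e) (1 - Real.exp (-(h * r e)))) * stepOp a r l :=
      funext fun h => List.prod_cons
    rw [h5, List.map_cons, List.sum_cons]
    exact h3

/-- The generator of the finite system in which the map `a e`, for `e ∈ K`, is applied at
rate `r e`. -/
noncomputable def finGen (a : ι → C(Y, Y)) (r : ι → ℝ≥0) (K : Finset ι) :
    BoundedOp (Y →ᵇ ℝ) :=
  ∑ e ∈ K, (r e : ℝ) • (koopman (a e) - 1)

theorem tendsto_stepOp_pow [LinearOrder ι] (a : ι → C(Y, Y)) (r : ι → ℝ≥0)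
    (K : Finset ι) (t : ℝ≥0) :
    Tendsto (fun m : ℕ => stepOp a r (K.sort (· ≤ ·)) (t / m) ^ m) atTop
      (𝓝 (NormedSpace.exp ((t : ℝ) • finGen a r K))) := by
  have hL : finGen a r K =
      ((K.sort (· ≤ ·)).map fun e => (r e : ℝ) • (koopman (a e) - 1)).sum := by
    rw [finGen, ← List.sum_toFinset _ (Finset.sort_nodup _ _), Finset.sort_toFinset]
  rw [hL]
  exact tendsto_pow_exp (stepOp_zero _ _ _) (fun h hh => norm_stepOp_le _ _ _ hh)
    (hasDerivAt_stepOp _ _ _) t.2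

end Koopman

section RandomMaps

variable {Y : Type*} [TopologicalSpace Y] [MeasurableSpace Y] [BorelSpace Y]

theorem measurable_foldl_ite {Ω I : Type*} [MeasurableSpace Ω] (a : I → C(Y, Y))
    (B : I → Ω → Prop) [∀ i ω, Decidable (B i ω)] (l : List I)
    (hB : ∀ i ∈ l, MeasurableSet {ω | B i ω}) {Z : Ω → Y} (hZ : Measurable Z) :
    Measurable fun ω => l.foldl (fun y i => if B i ω then a i y else y) (Z ω) := by
  induction l generalizing Z with
  | nil => exact hZ
  | cons i l ih =>
    simp only [List.foldl_cons]
    refine ih (fun j hj => hB j (by simp [hj])) ?_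
    exact Measurable.ite (hB i (by simp)) ((a i).continuous.measurable.comp hZ) hZ

/-- Applying independently maps `a i` when `X i > 0`, one after the other, the expectation operator
is the product of the individual ones. -/
theorem integral_foldl_ite {Ω I : Type*} [MeasurableSpace Ω] {P : Measure Ω}
    [IsProbabilityMeasure P] (a : I → C(Y, Y)) {X : I → Ω → ℕ} (hX : ∀ i, Measurable (X i))
    (hind : iIndepFun X P) (f : Y →ᵇ ℝ) (l : List I) (hl : l.Nodup) (y : Y) :
    ∫ ω, f (l.foldl (fun y i => if 0 < X i ω then a i y else y) y) ∂P =
      (l.map fun i => lazyOp (a i) (P.real {ω | 0 < X i ω})).prod f y := by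
  have hB : ∀ i, MeasurableSet {ω | 0 < X i ω} := fun i => measurableSet_lt measurable_const (hX i)
  have hmeas : ∀ (l : List I) (y : Y),
      Measurable fun ω => f (l.foldl (fun y i => if 0 < X i ω then a i y else y) y) :=
    fun l y => f.continuous.measurable.comp
      (measurable_foldl_ite a (fun i ω => 0 < X i ω) l (fun i _ => hB i) measurable_const)
  have hint : ∀ (l : List I) (y : Y),
      Integrable (fun ω => f (l.foldl (fun y i => if 0 < X i ω then a i y else y) y)) P :=
    fun l y => Integrable.of_bound (hmeas l y).aestronglyMeasurable ‖f‖
      (Eventually.of_forall fun ω => f.norm_coe_le_norm _)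
  induction l generalizing y with
  | nil => simp
  | cons i l ih =>
    obtain ⟨hil, hl'⟩ := List.nodup_cons.1 hl
    set B : Set Ω := {ω | 0 < X i ω} with hBdef
    set G : Y → Ω → ℝ := fun y ω =>
      f (l.foldl (fun y i => if 0 < X i ω then a i y else y) y) with hG
    -- the tail of the product only involves `X j` for `j ∈ l`, so it is independent of `X i`
    have hindG : ∀ y, IndepFun (B.indicator fun _ => (1 : ℝ)) (G y) P := by
      intro y
      have h1 := indep_iSup_of_disjoint (fun j => (hX j).comap_le)
        ((iIndepFun_iff_iIndep _ _ _).1 hind) (S := {i}) (T := {j | j ∈ l})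
        (by simpa using hil)
      rw [IndepFun_iff_Indep]
      refine indep_of_indep_of_le_left (indep_of_indep_of_le_right h1 ?_) ?_
      · rw [← measurable_iff_comap_le]
        refine f.continuous.measurable.comp (@measurable_foldl_ite Y _ _ _ Ω I
          (⨆ j ∈ {j | j ∈ l}, MeasurableSpace.comap (X j) ⊤) a (fun i ω => 0 < X i ω) _ l
          (fun j hj => ?_) (fun _ => y) measurable_const)
        have h2 : MeasurableSpace.comap (X j) ⊤ ≤
            ⨆ j ∈ {j | j ∈ l}, MeasurableSpace.comap (X j) ⊤ :=
          le_iSup₂_of_le j hj le_rfl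
        exact h2 _ ⟨{n | 0 < n}, trivial, rfl⟩
      · rw [← measurable_iff_comap_le]
        refine Measurable.indicator measurable_const ?_
        have h2 : MeasurableSpace.comap (X i) ⊤ ≤
            ⨆ j ∈ ({i} : Set I), MeasurableSpace.comap (X j) ⊤ :=
          le_iSup₂_of_le i rfl le_rfl
        exact h2 _ ⟨{n | 0 < n}, trivial, rfl⟩
    have hmul : ∀ y, ∫ ω, B.indicator (fun _ => (1 : ℝ)) ω * G y ω ∂P =
        P.real B * ∫ ω, G y ω ∂P := by
      intro y
      rw [(hindG y).integral_fun_mul_eq_mul_integral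
        (measurable_const.indicator (hB i)).aestronglyMeasurable (hmeas l y).aestronglyMeasurable,
        integral_indicator (hB i), integral_const, smul_eq_mul, mul_one,
        measureReal_restrict_apply_univ]
    have hintB : ∀ y, Integrable (fun ω => B.indicator (fun _ => (1 : ℝ)) ω * G y ω) P := by
      intro y
      refine (hint l y).bdd_mul (c := 1)
        (measurable_const.indicator (hB i)).aestronglyMeasurable
        (Eventually.of_forall fun ω => ?_)
      by_cases h : ω ∈ B <;> simp [h]
    have hsplit : ∀ ω, f ((i :: l).foldl (fun y i => if 0 < X i ω then a i y else y) y) =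
        B.indicator (fun _ => (1 : ℝ)) ω * G (a i y) ω +
          (G y ω - B.indicator (fun _ => (1 : ℝ)) ω * G y ω) := by
      intro ω
      by_cases h : 0 < X i ω
      · simp [hG, hBdef, h]
      · simp [hG, hBdef, h]
    simp_rw [hsplit]
    rw [integral_add (hintB _) (g := fun ω => G y ω - B.indicator (fun _ => (1 : ℝ)) ω * G y ω)
      ((hint l y).sub (hintB _)), integral_sub (hint l y) (hintB _),
      hmul, hmul, ih hl' (a i y), ih hl' y, List.map_cons, List.prod_cons,
      mul_apply_eq_comp, lazyOp_apply]
    ring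

end RandomMaps

end Exclusion

/-! ### Finite systems driven by independent Poisson processes -/

namespace Exclusion

open Filter Topology BoundedContinuousFunction

/-- The state at time `t` of the system started from `y` in which the map `a e`, for `e ∈ K`, is
applied at each jump of the path `c e`. -/
noncomputable def finFlow {ι Y : Type*} [LinearOrder ι] (a : ι → Y → Y) (c : ι → ℝ≥0 → ℕ)
    (K : Finset ι) (t : ℝ≥0) (y : Y) : Y :=
  (jumpList c K 0 t).foldl (fun y e => a e y) y

section PoissonDriven

variable {ι : Type*} {Ω : Type*} [MeasurableSpace Ω] {P : Measure Ω}
  {c : ι → ℝ≥0 → Ω → ℕ} {r : ι → ℝ≥0}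

theorem measureReal_increment_pos [IsProbabilityMeasure P] {r : ℝ≥0} {c : ℝ≥0 → Ω → ℕ}
    (hc : IsPoissonProcess P r c) {s t : ℝ≥0} (hst : s ≤ t) :
    P.real {ω | 0 < c t ω - c s ω} = 1 - Real.exp (-((t - s : ℝ≥0) * r)) := by
  have hm : Measurable fun ω => c t ω - c s ω := (hc.measurable t).sub (hc.measurable s)
  have h0 : P.real {ω | c t ω - c s ω = 0} = Real.exp (-((t - s : ℝ≥0) * r)) := by
    have h1 := congrArg (fun μ => μ.real {0}) (hc.law s t hst)
    simp only [poissonMeasure_real_singleton, pow_zero, Nat.factorial_zero, Nat.cast_one,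
      mul_one, div_one] at h1
    rw [map_measureReal_apply hm (measurableSet_singleton 0)] at h1
    exact h1
  have h2 : {ω | 0 < c t ω - c s ω} = {ω | c t ω - c s ω = 0}ᶜ := by
    ext ω; exact Nat.pos_iff_ne_zero
  rw [h2, probReal_compl_eq_one_sub (s := {ω | c t ω - c s ω = 0})
    (hm (measurableSet_singleton 0)), h0]

theorem iIndepFun_increments (hc : ∀ e, IsPoissonProcess P (r e) (c e))
    (hind : iIndepFun (fun e ω t => c e t ω) P) {u : ℕ → ℝ≥0} (hu : Monotone u) :
    iIndepFun (fun (q : ι × ℕ) ω => c q.1 (u (q.2 + 1)) ω - c q.1 (u q.2) ω) P := by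
  refine iIndepFun_uncurry' (X := fun e k ω => c e (u (k + 1)) ω - c e (u k) ω)
    (fun e k => ((hc e).measurable _).sub ((hc e).measurable _)) ?_
    (fun e => (hc e).indep.nat hu)
  refine hind.comp (fun _ path k => path (u (k + 1)) - path (u k)) fun e => ?_
  exact measurable_pi_lambda _ fun k =>
    (measurable_pi_apply (u (k + 1))).sub (measurable_pi_apply (u k))

variable [LinearOrder ι]

theorem foldl_gridList {Y : Type*} (a : ι → Y → Y) (c : ι → ℝ≥0 → ℕ) (K : Finset ι) (t : ℝ≥0)
    (m : ℕ) (y : Y) :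
    (gridList c K t m).foldl (fun y e => a e y) y =
      ((List.range m).flatMap fun k => (K.sort (· ≤ ·)).map fun e => (e, k)).foldl
        (fun y q => if 0 < c q.1 (((q.2 + 1 : ℕ) : ℝ≥0) * (t / m)) - c q.1 ((q.2 : ℝ≥0) * (t / m))
          then a q.1 y else y) y := by
  rw [gridList, List.foldl_flatMap, List.foldl_flatMap]
  congr 1
  funext y k
  rw [List.foldl_filter, List.foldl_map]
  simp only [decide_eq_true_eq, tsub_pos_iff_lt]

theorem eventually_foldl_gridList_eq (hc : ∀ e, IsPoissonProcess P (r e) (c e))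
    {Y : Type*} (a : ι → Y → Y) (K : Finset ι) (t : ℝ≥0) (y : Y) (ω : Ω) :
    ∀ᶠ m in atTop, (gridList (fun e s => c e s ω) K t m).foldl (fun y e => a e y) y =
      finFlow a (fun e s => c e s ω) K t y := by
  filter_upwards [eventually_gridList_eq (fun e => (hc e).mono ω) (fun e => (hc e).rightCont ω) K t]
    with m hm
  rw [hm, finFlow]

variable {Y : Type*} [TopologicalSpace Y] [MeasurableSpace Y] [BorelSpace Y]

theorem measurable_foldl_gridList (hc : ∀ e t, Measurable (c e t)) (a : ι → C(Y, Y))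
    (K : Finset ι) (t : ℝ≥0) (m : ℕ) :
    Measurable fun q : Y × Ω =>
      (gridList (fun e s => c e s q.2) K t m).foldl (fun y e => a e y) q.1 := by
  simp only [foldl_gridList (fun e => ⇑(a e))]
  refine measurable_foldl_ite (fun q : ι × ℕ => a q.1) (fun (q : ι × ℕ) (x : Y × Ω) =>
    0 < c q.1 (((q.2 + 1 : ℕ) : ℝ≥0) * (t / m)) x.2 - c q.1 ((q.2 : ℝ≥0) * (t / m)) x.2) _
    (fun q _ => ?_) measurable_fst
  exact measurableSet_lt measurable_const
    (((hc _ _).comp measurable_snd).sub ((hc _ _).comp measurable_snd))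

theorem measurable_finFlow [TopologicalSpace.PseudoMetrizableSpace Y]
    (hc : ∀ e, IsPoissonProcess P (r e) (c e)) (a : ι → C(Y, Y)) (K : Finset ι) (t : ℝ≥0) :
    Measurable fun q : Y × Ω => finFlow (fun e => ⇑(a e)) (fun e s => c e s q.2) K t q.1 := by
  refine measurable_of_tendsto_metrizable
    (fun m => measurable_foldl_gridList (fun e => (hc e).measurable) a K t m) ?_
  rw [tendsto_pi_nhds]
  exact fun q => tendsto_nhds_of_eventually_eq
    (eventually_foldl_gridList_eq hc (fun e => ⇑(a e)) K t q.1 q.2)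

theorem integral_foldl_gridList [IsProbabilityMeasure P]
    (hc : ∀ e, IsPoissonProcess P (r e) (c e)) (hind : iIndepFun (fun e ω t => c e t ω) P)
    (a : ι → C(Y, Y)) (K : Finset ι) (t : ℝ≥0) (m : ℕ) (f : Y →ᵇ ℝ) (y : Y) :
    ∫ ω, f ((gridList (fun e s => c e s ω) K t m).foldl (fun y e => a e y) y) ∂P =
      (stepOp a r (K.sort (· ≤ ·)) (t / m) ^ m) f y := by
  have hu : Monotone fun k : ℕ => (k : ℝ≥0) * (t / m) := fun i j hij => by
    simp only; gcongr
  simp only [foldl_gridList (fun e => ⇑(a e))]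
  have hnodup : ((List.range m).flatMap fun k =>
      (K.sort (· ≤ ·)).map fun e => (e, k)).Nodup := by
    refine List.nodup_flatMap.2 ⟨fun k _ => (Finset.sort_nodup K _).map fun x y h =>
      congrArg Prod.fst h, ?_⟩
    refine List.nodup_range.imp fun {k k'} hkk' => ?_
    rw [Function.onFun, List.disjoint_left]
    intro x hx hx'
    obtain ⟨e, -, rfl⟩ := List.mem_map.1 hx
    obtain ⟨e', -, h'⟩ := List.mem_map.1 hx'
    exact hkk' (congrArg Prod.snd h').symm
  have key := integral_foldl_ite (P := P) (fun q : ι × ℕ => a q.1)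
    (X := fun q ω => c q.1 (((q.2 + 1 : ℕ) : ℝ≥0) * (t / m)) ω - c q.1 ((q.2 : ℝ≥0) * (t / m)) ω)
    (fun q : ι × ℕ => ((hc q.1).measurable (((q.2 + 1 : ℕ) : ℝ≥0) * (t / m))).sub
      ((hc q.1).measurable ((q.2 : ℝ≥0) * (t / m))))
    (iIndepFun_increments hc hind hu) f _ hnodup y
  refine key.trans ?_
  have hq : ∀ q : ι × ℕ, P.real {ω | 0 < c q.1 (((q.2 + 1 : ℕ) : ℝ≥0) * (t / m)) ω -
      c q.1 ((q.2 : ℝ≥0) * (t / m)) ω} = 1 - Real.exp (-((t / m : ℝ) * r q.1)) := by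
    intro q
    rw [measureReal_increment_pos (hc q.1) (hu q.2.le_succ)]
    have : ((q.2 + 1 : ℕ) : ℝ≥0) * (t / m) - (q.2 : ℝ≥0) * (t / m) = t / m := by
      rw [Nat.cast_succ, add_mul, one_mul, add_tsub_cancel_left]
    rw [this]
    push_cast
    rfl
  congr 2
  simp only [hq]
  generalize (t / m : ℝ) = h
  clear key hq hnodup hu
  induction m with
  | zero => rfl
  | succ m ih =>
    rw [List.range_succ, List.flatMap_append, List.map_append, List.prod_append, ih, pow_succ]
    congr 1
    simp [stepOp, Function.comp_def]

/-- The transition operator of a finite system is the exponential of its generator. -/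
theorem integral_finFlow [IsProbabilityMeasure P]
    (hc : ∀ e, IsPoissonProcess P (r e) (c e)) (hind : iIndepFun (fun e ω t => c e t ω) P)
    (a : ι → C(Y, Y)) (K : Finset ι) (t : ℝ≥0) (f : Y →ᵇ ℝ) (y : Y) :
    ∫ ω, f (finFlow (fun e => ⇑(a e)) (fun e s => c e s ω) K t y) ∂P =
      NormedSpace.exp ((t : ℝ) • finGen a r K) f y := by
  have h1 : Tendsto (fun m : ℕ =>
      ∫ ω, f ((gridList (fun e s => c e s ω) K t m).foldl (fun y e => a e y) y) ∂P) atTop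
      (𝓝 (∫ ω, f (finFlow (fun e => ⇑(a e)) (fun e s => c e s ω) K t y) ∂P)) := by
    refine tendsto_integral_of_dominated_convergence (fun _ => ‖f‖) (fun m => ?_)
      (integrable_const _) (fun m => Eventually.of_forall fun ω => f.norm_coe_le_norm _)
      (Eventually.of_forall fun ω => tendsto_nhds_of_eventually_eq ?_)
    · exact (f.continuous.measurable.comp ((measurable_foldl_gridList
        (fun e => (hc e).measurable) a K t m).comp measurable_prodMk_left)).aestronglyMeasurable
    · filter_upwards [eventually_foldl_gridList_eq hc (fun e => ⇑(a e)) K t y ω] with m hm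
      rw [hm]
  have h2 : Tendsto (fun m : ℕ => (stepOp a r (K.sort (· ≤ ·)) (t / m) ^ m) f y) atTop
      (𝓝 (NormedSpace.exp ((t : ℝ) • finGen a r K) f y)) := by
    have h3 : Continuous fun T : BoundedOp (Y →ᵇ ℝ) => T f y :=
      (BoundedContinuousFunction.evalCLM ℝ y).continuous.comp
        (ContinuousLinearMap.apply ℝ (Y →ᵇ ℝ) f).continuous
    exact (h3.tendsto _).comp (tendsto_stepOp_pow a r K t)
  simp only [integral_foldl_gridList hc hind] at h1
  exact tendsto_nhds_unique h1 h2

end PoissonDriven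

end Exclusion

/-! ### Uncrossed sites -/

namespace Exclusion

open Filter Topology

/-- The ordered pairs of sites that lie on different sides of `i`, that is, one below `i` and the
other at or above `i`. -/
def crossingEdges (i : ℤ) : Set (ℤ × ℤ) :=
  {e | (e.1 < i ∧ i ≤ e.2) ∨ (e.2 < i ∧ i ≤ e.1)}

theorem noCrossing_iff {n : ℤ → ℤ → ℝ≥0 → ℕ} {i : ℤ} {t : ℝ≥0} :
    NoCrossing n i t ↔ ∀ e ∈ crossingEdges i, n e.1 e.2 t = 0 := by
  constructor
  · rintro h ⟨x, y⟩ (⟨hx, hy⟩ | ⟨hx, hy⟩)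
    · exact (h x y hx hy).1
    · exact (h y x hx hy).2
  · intro h x y hx hy
    exact ⟨h (x, y) (Or.inl ⟨hx, hy⟩), h (y, x) (Or.inr ⟨hx, hy⟩)⟩

/-- The total rate of the jumps across a site is at most the first absolute moment: a jump of
size `d` can cross `i` from `|d|` starting points. -/
theorem sum_crossing_le {p : ℤ → ℤ → ℝ≥0} (hp_transl : ∀ x y, p x y = p 0 (y - x))
    (hp_moment : Summable fun x : ℤ => |(x : ℝ)| * (p 0 x : ℝ)) (i : ℤ) (F : Finset (ℤ × ℤ))
    (hF : ∀ e ∈ F, e ∈ crossingEdges i) :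
    ∑ e ∈ F, (p e.1 e.2 : ℝ) ≤ ∑' d : ℤ, |(d : ℝ)| * (p 0 d : ℝ) := by
  have h1 : ∑ e ∈ F, (p e.1 e.2 : ℝ) = ∑ e ∈ F, (p 0 (e.2 - e.1) : ℝ) :=
    Finset.sum_congr rfl fun e _ => by rw [hp_transl]
  rw [h1, Finset.sum_comp (fun d => (p 0 d : ℝ)) fun e : ℤ × ℤ => e.2 - e.1]
  refine (Finset.sum_le_sum fun d _ => ?_).trans
    (hp_moment.sum_le_tsum _ fun d _ => by positivity)
  rw [nsmul_eq_mul]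
  gcongr
  have hcard : (F.filter fun e : ℤ × ℤ => e.2 - e.1 = d).card ≤ d.natAbs := by
    have h2 : (Finset.Ico (min i (i - d)) (max i (i - d))).card = d.natAbs := by
      rw [Int.card_Ico]; omega
    rw [← h2]
    refine Finset.card_le_card_of_injOn Prod.fst (fun e he => ?_) fun e he e' he' h => ?_
    · obtain ⟨he1, he2⟩ := Finset.mem_filter.1 he
      simp only [Finset.coe_Ico, mem_Ico]
      rcases hF e he1 with h | h <;> omega
    · have h3 := (Finset.mem_filter.1 he).2
      have h4 := (Finset.mem_filter.1 he').2
      exact Prod.ext h (by omega)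
  calc ((F.filter fun e : ℤ × ℤ => e.2 - e.1 = d).card : ℝ) ≤ (d.natAbs : ℝ) := by
        exact_mod_cast hcard
    _ = |(d : ℝ)| := by rw [Nat.cast_natAbs]; push_cast; rfl

theorem measurableSet_noCrossing {Ω : Type*} {m : MeasurableSpace Ω}
    {N : ℤ → ℤ → ℝ≥0 → Ω → ℕ} {i : ℤ} {t : ℝ≥0}
    (h : ∀ e ∈ crossingEdges i, MeasurableSet[m] {ω | N e.1 e.2 t ω = 0}) :
    MeasurableSet[m] {ω | NoCrossing (fun x y s => N x y s ω) i t} := by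
  have h1 : {ω | NoCrossing (fun x y s => N x y s ω) i t} =
      ⋂ e ∈ crossingEdges i, {ω | N e.1 e.2 t ω = 0} := by
    ext ω; simp [noCrossing_iff]
  rw [h1]
  exact MeasurableSet.biInter (crossingEdges i).to_countable h

section

variable {Ω : Type*} [MeasurableSpace Ω] {P : Measure Ω} {p : ℤ → ℤ → ℝ≥0}
  {N : ℤ → ℤ → ℝ≥0 → Ω → ℕ}

theorem measure_eq_zero_of_poisson {r : ℝ≥0} {c : ℝ≥0 → Ω → ℕ} (hc : IsPoissonProcess P r c)
    (t : ℝ≥0) : P {ω | c t ω = 0} = ENNReal.ofReal (Real.exp (-(t * r))) := by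
  have h1 := congrArg (fun μ => μ {0}) (hc.law 0 t zero_le)
  simp only [hc.zero, tsub_zero, poissonMeasure_singleton, pow_zero, Nat.factorial_zero,
    Nat.cast_one, mul_one, div_one] at h1
  rw [Measure.map_apply (hc.measurable t) (measurableSet_singleton 0)] at h1
  refine Eq.trans ?_ (h1.trans ?_)
  · rfl
  · push_cast; rfl

theorem le_measure_noCrossing [IsProbabilityMeasure P]
    (hp_transl : ∀ x y, p x y = p 0 (y - x))
    (hp_moment : Summable fun x : ℤ => |(x : ℝ)| * (p 0 x : ℝ))
    (hN : IsPoissonFamily P p N) (i : ℤ) (t : ℝ≥0) :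
    ENNReal.ofReal (Real.exp (-(t * ∑' d : ℤ, |(d : ℝ)| * (p 0 d : ℝ)))) ≤
      P {ω | NoCrossing (fun x y s => N x y s ω) i t} := by
  classical
  set Z : ℤ × ℤ → Set Ω := fun e => {ω | N e.1 e.2 t ω = 0} with hZ
  have hZm : ∀ e, MeasurableSet (Z e) := fun e =>
    (hN.poisson e.1 e.2).measurable t (measurableSet_singleton 0)
  set A : Finset (ℤ × ℤ) → Set Ω := fun F => ⋂ e ∈ F.filter (· ∈ crossingEdges i), Z e with hA
  have hAm : ∀ F, MeasurableSet (A F) := fun F =>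
    MeasurableSet.biInter (Finset.countable_toSet _) fun e _ => hZm e
  have hAanti : Antitone A := fun F G hFG =>
    biInter_subset_biInter_left (fun e he => Finset.filter_subset_filter _ hFG he)
  have h1 : {ω | NoCrossing (fun x y s => N x y s ω) i t} = ⋂ F, A F := by
    ext ω
    simp only [mem_ofPred_eq, noCrossing_iff, hA, mem_iInter, hZ, Finset.mem_filter]
    exact ⟨fun h F e he => h e he.2, fun h e he => h {e} e ⟨by simp, he⟩⟩
  rw [h1, hAanti.directed_ge.measure_iInter (fun F => (hAm F).nullMeasurableSet)
    ⟨∅, measure_ne_top _ _⟩]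
  refine le_iInf fun F => ?_
  have hind : iIndepFun (fun (e : ℤ × ℤ) ω => N e.1 e.2 t ω) P :=
    hN.indep.comp (fun _ path => path t) fun e => measurable_pi_apply t
  have h2 := hind.measure_inter_preimage_eq_mul (F.filter (· ∈ crossingEdges i))
    (sets := fun _ => {0}) (fun e _ => measurableSet_singleton 0)
  have h3 : A F = ⋂ e ∈ F.filter (· ∈ crossingEdges i), (fun ω => N e.1 e.2 t ω) ⁻¹' {0} := rfl
  rw [h3, h2]
  have h4 : ∀ e : ℤ × ℤ, P ((fun ω => N e.1 e.2 t ω) ⁻¹' {0}) =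
      ENNReal.ofReal (Real.exp (-(t * p e.1 e.2))) := fun e =>
    measure_eq_zero_of_poisson (hN.poisson e.1 e.2) t
  simp only [h4]
  rw [← ENNReal.ofReal_prod_of_nonneg fun _ _ => (Real.exp_pos _).le, ← Real.exp_sum,
    Finset.sum_neg_distrib, ← Finset.mul_sum]
  refine ENNReal.ofReal_le_ofReal (Real.exp_le_exp.2 (neg_le_neg ?_))
  exact mul_le_mul_of_nonneg_left (sum_crossing_le hp_transl hp_moment i _
    fun e he => (Finset.mem_filter.1 he).2) t.2

/-- Along any sequence of sites tending to infinity there are almost surely infinitely many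
uncrossed sites. A single pair of sites only crosses finitely many sites, so this is a tail event,
and its probability is positive. -/
theorem ae_frequently_noCrossing [IsProbabilityMeasure P]
    (hp_transl : ∀ x y, p x y = p 0 (y - x))
    (hp_moment : Summable fun x : ℤ => |(x : ℝ)| * (p 0 x : ℝ))
    (hN : IsPoissonFamily P p N) (t : ℝ≥0) {g : ℕ → ℤ}
    (hg : ∀ e : ℤ × ℤ, ∀ᶠ k in atTop, e ∉ crossingEdges (g k)) :
    ∀ᵐ ω ∂P, ∃ᶠ k in atTop, NoCrossing (fun x y s => N x y s ω) (g k) t := by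
  set C : ℕ → Set Ω := fun k => {ω | NoCrossing (fun x y s => N x y s ω) (g k) t} with hC
  have hCm : ∀ k, MeasurableSet (C k) := fun k => measurableSet_noCrossing fun e _ =>
    (hN.poisson e.1 e.2).measurable t (measurableSet_singleton 0)
  set E : Set Ω := ⋂ n, ⋃ k ≥ n, C k with hE
  have hEm : MeasurableSet E := MeasurableSet.iInter fun n =>
    MeasurableSet.iUnion fun k => MeasurableSet.iUnion fun _ => hCm k
  have hmem : ∀ ω, ω ∈ E ↔ ∃ᶠ k in atTop, NoCrossing (fun x y s => N x y s ω) (g k) t := by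
    intro ω
    simp [hE, hC, frequently_atTop]
  have hpos : P E ≠ 0 := by
    have h1 : Antitone fun n => ⋃ k ≥ n, C k := fun n m hnm =>
      biUnion_subset_biUnion_left fun k (hk : m ≤ k) => hnm.trans hk
    rw [hE, h1.measure_iInter (fun n => (MeasurableSet.iUnion fun k =>
      MeasurableSet.iUnion fun _ => hCm k).nullMeasurableSet) ⟨0, measure_ne_top _ _⟩]
    have h2 : ENNReal.ofReal (Real.exp (-(t * ∑' d : ℤ, |(d : ℝ)| * (p 0 d : ℝ)))) ≤
        ⨅ n, P (⋃ k ≥ n, C k) := le_iInf fun n =>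
      (le_measure_noCrossing hp_transl hp_moment hN (g n) t).trans
        (measure_mono (subset_biUnion_of_mem (u := C) (le_refl n)))
    exact ((ENNReal.ofReal_pos.2 (Real.exp_pos _)).trans_le h2).ne'
  set s : ℤ × ℤ → MeasurableSpace Ω := fun e =>
    MeasurableSpace.comap (fun ω t => N e.1 e.2 t ω) inferInstance with hs
  have htail : MeasurableSet[limsup s cofinite] E := by
    rw [limsup_eq_iInf_iSup, MeasurableSpace.measurableSet_iInf]
    intro S
    rw [MeasurableSpace.measurableSet_iInf]
    intro hS
    -- beyond some `n₀`, only pairs in `S` can cross `g k`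
    obtain ⟨n₀, hn₀⟩ : ∃ n₀, ∀ k ≥ n₀, ∀ e ∈ Sᶜ, e ∉ crossingEdges (g k) := by
      rw [← eventually_atTop]
      exact ((mem_cofinite.1 hS).eventually_all).2 fun e _ => hg e
    have hE' : E = ⋂ n, ⋃ k ≥ max n n₀, C k := by
      refine Subset.antisymm (fun ω hω => ?_) fun ω hω => ?_
      · exact mem_iInter.2 fun n => mem_iInter.1 hω (max n n₀)
      · refine mem_iInter.2 fun n => ?_
        obtain ⟨k, hk, h⟩ := mem_iUnion₂.1 (mem_iInter.1 hω n)
        exact mem_iUnion₂.2 ⟨k, (le_max_left _ _).trans hk, h⟩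
    rw [hE']
    refine MeasurableSet.iInter fun n => MeasurableSet.iUnion fun k =>
      MeasurableSet.iUnion fun hk => measurableSet_noCrossing fun e he => ?_
    have heS : e ∈ S := by
      by_contra h
      exact hn₀ k ((le_max_right _ _).trans hk) e h he
    have hle : s e ≤ ⨆ a ∈ S, s a := le_iSup₂_of_le e heS le_rfl
    refine hle _ ⟨{path | path t = 0}, ?_, rfl⟩
    exact measurable_pi_apply t (measurableSet_singleton 0)
  have h01 := measure_zero_or_one_of_measurableSet_limsup (μ := P) (s := s) (f := cofinite)
    (p := Set.Finite) (ns := fun F : Finset (ℤ × ℤ) => (F : Set (ℤ × ℤ)))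
    (fun e => (measurable_pi_lambda _ fun t => (hN.poisson e.1 e.2).measurable t).comap_le)
    ((iIndepFun_iff_iIndep _ _ _).1 hN.indep)
    (fun S hS => by simpa using hS)
    (Monotone.directed_le fun F G h => Finset.coe_subset.2 h) (fun F => F.finite_toSet)
    (fun e => ⟨{e}, by simp⟩) htail
  have h1 : P E = 1 := h01.resolve_left hpos
  have h2 : ∀ᵐ ω ∂P, ω ∈ E := (prob_compl_eq_zero_iff hEm).2 h1
  filter_upwards [h2] with ω hω using (hmem ω).1 hω

/-- Almost surely every site lies in a window with uncrossed boundaries. -/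
theorem ae_exists_noCrossing [IsProbabilityMeasure P]
    (hp_transl : ∀ x y, p x y = p 0 (y - x))
    (hp_moment : Summable fun x : ℤ => |(x : ℝ)| * (p 0 x : ℝ))
    (hN : IsPoissonFamily P p N) (t : ℝ≥0) :
    ∀ᵐ ω ∂P, ∀ z : ℤ, ∃ i j : ℤ, i ≤ z ∧ z < j ∧
      NoCrossing (fun x y s => N x y s ω) i t ∧ NoCrossing (fun x y s => N x y s ω) j t := by
  have h1 := ae_frequently_noCrossing hp_transl hp_moment hN t (g := fun k => -(k : ℤ)) fun e => by
    filter_upwards [eventually_gt_atTop (e.1.natAbs + e.2.natAbs)] with k hk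
    rintro (h | h) <;> omega
  have h2 := ae_frequently_noCrossing hp_transl hp_moment hN t (g := fun k => (k : ℤ)) fun e => by
    filter_upwards [eventually_gt_atTop (e.1.natAbs + e.2.natAbs)] with k hk
    rintro (h | h) <;> omega
  filter_upwards [h1, h2] with ω hω1 hω2 z
  obtain ⟨k, hk, hk'⟩ := frequently_atTop.1 hω1 z.natAbs
  obtain ⟨l, hl, hl'⟩ := frequently_atTop.1 hω2 (z.natAbs + 1)
  exact ⟨-(k : ℤ), l, by omega, by omega, hk', hl'⟩

end

end Exclusion

/-! ### Locality of the graphical construction -/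

namespace Exclusion

open Filter Topology

theorem attempt_apply (x y : ℤ) (η : Config) (z : ℤ) :
    attempt x y η z = if z = y then η y || η x else if z = x then η x && η y else η z := by
  unfold attempt
  by_cases h : η x = true ∧ η y = false
  · rw [if_pos h]
    by_cases hy : z = y
    · subst hy; simp [h]
    · by_cases hx : z = x
      · subst hx; simp [hy, h]
      · simp [hy, hx]
  · rw [if_neg h]
    by_cases hy : z = y
    · subst hy
      rw [if_pos rfl]
      cases hx : η x <;> cases hy : η z <;> simp_all
    · by_cases hx : z = x
      · subst hx
        rw [if_neg hy, if_pos rfl]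
        cases hx : η z <;> cases hy : η y <;> simp_all
      · simp [hy, hx]

theorem attempt_apply_of_ne {x y z : ℤ} (hx : z ≠ x) (hy : z ≠ y) (η : Config) :
    attempt x y η z = η z := by
  rw [attempt_apply, if_neg hy, if_neg hx]

theorem monotone_attempt (x y : ℤ) : Monotone (attempt x y) := by
  intro η ζ h z
  have hx := h x
  have hy := h y
  have hz := h z
  rw [attempt_apply, attempt_apply]
  have hor : ∀ a b c d : Bool, a ≤ c → b ≤ d → (b || a) ≤ (d || c) := by decide
  have hand : ∀ a b c d : Bool, a ≤ c → b ≤ d → (a && b) ≤ (c && d) := by decide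
  split_ifs
  · exact hor _ _ _ _ hx hy
  · exact hand _ _ _ _ hx hy
  · exact hz

theorem continuous_attempt (x y : ℤ) : Continuous (attempt x y) := by
  refine continuous_pi fun z => ?_
  simp only [attempt_apply]
  have h2 : ∀ f : Bool × Bool → Bool, Continuous fun η : Config => f (η x, η y) := fun f =>
    continuous_of_discreteTopology.comp ((continuous_apply x).prodMk (continuous_apply y))
  split_ifs
  · exact h2 fun b => b.2 || b.1
  · exact h2 fun b => b.1 && b.2
  · exact continuous_apply z

/-- The jump attempt along an ordered pair of sites. -/
def attemptEdge (e : ℤ ×ₗ ℤ) (η : Config) : Config := attempt (ofLex e).1 (ofLex e).2 η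

/-- Inside `W`, the result of a list of updates depends only on those that act inside `W`, if the
other ones do not touch `W`. -/
theorem foldl_eq_foldl_filter {act : ℤ ×ₗ ℤ → Config → Config} {W : Set ℤ} (S : Finset (ℤ ×ₗ ℤ))
    (l : List (ℤ ×ₗ ℤ)) (hS : ∀ e ∈ S, (ofLex e).1 ∈ W ∧ (ofLex e).2 ∈ W)
    (hin : ∀ e ∈ S, act e = attemptEdge e)
    (hout : ∀ e ∈ l, e ∉ S → ∀ η, ∀ z ∈ W, act e η z = η z) {η η' : Config}
    (hη : ∀ z ∈ W, η z = η' z) :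
    ∀ z ∈ W, l.foldl (fun ζ e => act e ζ) η z =
      (l.filter fun e => e ∈ S).foldl (fun ζ e => attemptEdge e ζ) η' z := by
  induction l generalizing η η' with
  | nil => exact hη
  | cons e l ih =>
    have hout' : ∀ e ∈ l, e ∉ S → ∀ η, ∀ z ∈ W, act e η z = η z :=
      fun e he => hout e (List.mem_cons_of_mem _ he)
    by_cases he : e ∈ S
    · rw [List.filter_cons_of_pos (by simpa using he), List.foldl_cons, List.foldl_cons]
      refine ih hout' fun z hz => ?_
      rw [hin e he, attemptEdge, attemptEdge, attempt_apply, attempt_apply,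
        hη _ (hS e he).1, hη _ (hS e he).2, hη z hz]
    · rw [List.filter_cons_of_neg (by simpa using he), List.foldl_cons]
      refine ih hout' fun z hz => ?_
      rw [hout e (by simp) he η z hz, hη z hz]

/-- Updates `act e`, `e ∈ K`, that look like the exclusion process to the window `[i, j - 1]`: the
pairs inside the window carry out their jump attempts, and a pair that crosses neither `i` nor `j`
and is not inside the window does not touch it. -/
structure LooksLikeExclusion (act : ℤ ×ₗ ℤ → Config → Config) (K : Finset (ℤ ×ₗ ℤ))
    (i j : ℤ) : Prop where
  subset : windowEdges i j ⊆ K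
  inside : ∀ e ∈ windowEdges i j, act e = attemptEdge e
  outside : ∀ e ∈ K, e ∉ windowEdges i j → ofLex e ∉ crossingEdges i → ofLex e ∉ crossingEdges j →
    ∀ η, ∀ z ∈ Ico i j, act e η z = η z

theorem finFlow_eq_windowEvolve {n : ℤ → ℤ → ℝ≥0 → ℕ} (hn : ∀ x y, Monotone (n x y))
    {act : ℤ ×ₗ ℤ → Config → Config} {K : Finset (ℤ ×ₗ ℤ)} {i j : ℤ} {t : ℝ≥0}
    (hi : NoCrossing n i t) (hj : NoCrossing n j t) (h : LooksLikeExclusion act K i j)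
    {η η' : Config} (hη : ∀ z ∈ Ico i j, η z = η' z) :
    ∀ z ∈ Ico i j, finFlow act (edgePaths n) K t η z = windowEvolve n i j t η' z := by
  have hc : ∀ e, Monotone (edgePaths n e) := fun e => hn _ _
  rw [windowEvolve_eq, jumpList_of_subset hc h.subset]
  refine foldl_eq_foldl_filter _ _ (fun e he => mem_windowEdges.1 he) h.inside ?_ hη
  intro e he heW
  obtain ⟨heK, s, hs0, hst, hs⟩ := (mem_jumpList hc).1 he
  have hpos : edgePaths n e t ≠ 0 :=
    (((Nat.zero_le _).trans_lt (hs.2 0 hs0)).trans_le (hc e hst)).ne'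
  exact h.outside e heK heW (fun hcr => hpos (noCrossing_iff.1 hi _ hcr))
    fun hcr => hpos (noCrossing_iff.1 hj _ hcr)

theorem looksLikeExclusion_windowEdges {i j i' j' : ℤ} (hi : i' ≤ i) (hj : j ≤ j') :
    LooksLikeExclusion attemptEdge (windowEdges i' j') i j where
  subset e he := by
    rw [mem_windowEdges, mem_Ico, mem_Ico] at he ⊢
    omega
  inside _ _ := rfl
  outside e _ he hci hcj η z hz := by
    rw [mem_windowEdges, mem_Ico, mem_Ico] at he
    rw [mem_Ico] at hz
    simp only [crossingEdges, mem_ofPred_eq] at hci hcj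
    exact attempt_apply_of_ne (by omega) (by omega) η

/-- Two windows with uncrossed boundaries give the same value at a common site. -/
theorem windowEvolve_congr {n : ℤ → ℤ → ℝ≥0 → ℕ} (hn : ∀ x y, Monotone (n x y))
    {i j i' j' z : ℤ} {t : ℝ≥0} (hi : NoCrossing n i t) (hj : NoCrossing n j t)
    (hi' : NoCrossing n i' t) (hj' : NoCrossing n j' t) (hz : z ∈ Ico i j) (hz' : z ∈ Ico i' j')
    (η : Config) : windowEvolve n i j t η z = windowEvolve n i' j' t η z := by
  rw [← finFlow_eq_windowEvolve hn hi hj (looksLikeExclusion_windowEdges (min_le_left i i')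
      (le_max_left j j')) (fun _ _ => rfl) z hz,
    ← finFlow_eq_windowEvolve hn hi' hj' (looksLikeExclusion_windowEdges (min_le_right i i')
      (le_max_right j j')) (fun _ _ => rfl) z hz']

theorem evolve_eq_windowEvolve {n : ℤ → ℤ → ℝ≥0 → ℕ} (hn : ∀ x y, Monotone (n x y))
    {i j z : ℤ} {t : ℝ≥0} (hi : NoCrossing n i t) (hj : NoCrossing n j t) (hz : z ∈ Ico i j)
    (η : Config) : evolve n t η z = windowEvolve n i j t η z := by
  rw [Bool.eq_iff_iff]
  simp only [evolve, decide_eq_true_eq]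
  constructor
  · rintro ⟨i', j', hi'z, hzj', hi', hj', h⟩
    rw [windowEvolve_congr hn hi hj hi' hj' hz ⟨hi'z, hzj'⟩, h]
  · intro h
    exact ⟨i, j, hz.1, hz.2, hi, hj, h⟩

theorem eventually_eqOn_Ico (i j : ℤ) (η₀ : Config) : ∀ᶠ η in 𝓝 η₀, ∀ w ∈ Ico i j, η w = η₀ w := by
  refine ((Set.finite_Ico i j).eventually_all).2 fun w _ => ?_
  have := (continuous_apply (A := fun _ : ℤ => Bool) w).tendsto η₀
  rwa [nhds_discrete Bool, tendsto_pure] at this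

theorem continuous_evolve {n : ℤ → ℤ → ℝ≥0 → ℕ} (hn : ∀ x y, Monotone (n x y)) {t : ℝ≥0}
    (hgood : ∀ z : ℤ, ∃ i j : ℤ, i ≤ z ∧ z < j ∧ NoCrossing n i t ∧ NoCrossing n j t) :
    Continuous (evolve n t) := by
  refine continuous_pi fun z => continuous_iff_continuousAt.2 fun η₀ => ?_
  obtain ⟨i, j, hiz, hzj, hi, hj⟩ := hgood z
  refine tendsto_nhds_of_eventually_eq ?_
  filter_upwards [eventually_eqOn_Ico i j η₀] with η hη
  have hself := looksLikeExclusion_windowEdges (le_refl i) (le_refl j)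
  rw [evolve_eq_windowEvolve hn hi hj ⟨hiz, hzj⟩, evolve_eq_windowEvolve hn hi hj ⟨hiz, hzj⟩,
    ← finFlow_eq_windowEvolve hn hi hj hself hη z ⟨hiz, hzj⟩,
    finFlow_eq_windowEvolve hn hi hj hself (fun _ _ => rfl) z ⟨hiz, hzj⟩]

/-- On paths with enough uncrossed sites, finite systems that look like the exclusion process
converge to it, also along converging initial configurations. -/
theorem tendsto_finFlow_evolve {n : ℤ → ℤ → ℝ≥0 → ℕ} (hn : ∀ x y, Monotone (n x y)) {t : ℝ≥0}
    (hgood : ∀ z : ℤ, ∃ i j : ℤ, i ≤ z ∧ z < j ∧ NoCrossing n i t ∧ NoCrossing n j t)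
    {act : ℕ → ℤ ×ₗ ℤ → Config → Config} {K : ℕ → Finset (ℤ ×ₗ ℤ)}
    (hact : ∀ i j, ∀ᶠ R in atTop, LooksLikeExclusion (act R) (K R) i j)
    {η : ℕ → Config} {η₀ : Config} (hη : Tendsto η atTop (𝓝 η₀)) :
    Tendsto (fun R => finFlow (act R) (edgePaths n) (K R) t (η R)) atTop
      (𝓝 (evolve n t η₀)) := by
  rw [tendsto_pi_nhds]
  intro z
  obtain ⟨i, j, hiz, hzj, hi, hj⟩ := hgood z
  rw [evolve_eq_windowEvolve hn hi hj ⟨hiz, hzj⟩]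
  refine tendsto_nhds_of_eventually_eq ?_
  filter_upwards [hact i j, hη.eventually (eventually_eqOn_Ico i j η₀)] with R hR hR'
  exact finFlow_eq_windowEvolve hn hi hj hR hR' z ⟨hiz, hzj⟩

theorem monotone_evolve (n : ℤ → ℤ → ℝ≥0 → ℕ) (t : ℝ≥0) : Monotone (evolve n t) := by
  have hfold : ∀ (l : List (ℤ ×ₗ ℤ)) {η ζ : Config}, η ≤ ζ →
      l.foldl (fun ζ e => attempt (ofLex e).1 (ofLex e).2 ζ) η ≤
        l.foldl (fun ζ e => attempt (ofLex e).1 (ofLex e).2 ζ) ζ := by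
    intro l
    induction l with
    | nil => exact fun h => h
    | cons e l ih => exact fun h => ih (monotone_attempt _ _ h)
  intro η ζ h z
  rw [Bool.le_iff_imp]
  simp only [evolve, decide_eq_true_eq]
  rintro ⟨i, j, hiz, hzj, hi, hj, hw⟩
  refine ⟨i, j, hiz, hzj, hi, hj, ?_⟩
  have h1 : windowEvolve n i j t η ≤ windowEvolve n i j t ζ := by
    rw [windowEvolve_eq, windowEvolve_eq]
    exact hfold _ h
  exact Bool.le_iff_imp.1 (h1 z) hw

/-! ### Periodic systems -/

/-- The representative of `x` modulo `4 R` in `[-2 R, 2 R)`. -/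
def wrap (R : ℕ) (x : ℤ) : ℤ := (x + 2 * R) % (4 * R) - 2 * R

theorem wrap_mem {R : ℕ} (hR : 0 < R) (x : ℤ) : wrap R x ∈ Finset.Ico (-2 * R : ℤ) (2 * R) := by
  have h1 := Int.emod_nonneg (x + 2 * R) (b := 4 * R) (by omega)
  have h2 := Int.emod_lt_of_pos (x + 2 * R) (b := 4 * R) (by omega)
  rw [Finset.mem_Ico, wrap]
  omega

theorem wrap_of_mem {R : ℕ} {x : ℤ} (hx : x ∈ Finset.Ico (-2 * R : ℤ) (2 * R)) :
    wrap R x = x := by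
  rw [Finset.mem_Ico] at hx
  rw [wrap, Int.emod_eq_of_lt (by omega) (by omega)]
  omega

theorem wrap_wrap_add (R : ℕ) (x d : ℤ) : wrap R (wrap R x + d) = wrap R (x + d) := by
  have h1 : wrap R x + d + 2 * R = (x + 2 * R) % (4 * R) + d := by rw [wrap]; ring
  have h2 : x + d + 2 * R = (x + 2 * R) + d := by ring
  rw [wrap, h1, Int.emod_add_emod, ← h2]
  rfl

/-- The rotation `x ↦ x + d` permutes a period. -/
theorem sum_wrap_add {R : ℕ} (hR : 0 < R) (g : ℤ → ℝ) (d : ℤ) :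
    ∑ x ∈ Finset.Ico (-2 * R : ℤ) (2 * R), g (wrap R (x + d)) =
      ∑ x ∈ Finset.Ico (-2 * R : ℤ) (2 * R), g x := by
  refine Finset.sum_nbij' (fun x => wrap R (x + d)) (fun x => wrap R (x - d))
    (fun x _ => wrap_mem hR _) (fun x _ => wrap_mem hR _) (fun x hx => ?_) (fun x hx => ?_)
    fun x _ => rfl
  · rw [sub_eq_add_neg, wrap_wrap_add, add_neg_cancel_right, wrap_of_mem hx]
  · rw [sub_eq_add_neg, wrap_wrap_add, neg_add_cancel_right, wrap_of_mem hx]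

/-- The ordered pairs `(x, y)` with `x ∈ [-2 R, 2 R)` and `|y - x| ≤ R`. -/
noncomputable def torusEdges (R : ℕ) : Finset (ℤ ×ₗ ℤ) :=
  (Finset.Ico (-2 * R : ℤ) (2 * R) ×ˢ Finset.Icc (-R : ℤ) R).map
    ⟨fun q => toLex (q.1, q.1 + q.2), fun q q' h => by
      have h1 := congrArg (fun e => (ofLex e).1) h
      have h2 := congrArg (fun e => (ofLex e).2) h
      simp only [ofLex_toLex] at h1 h2
      exact Prod.ext h1 (by omega)⟩

theorem mem_torusEdges {R : ℕ} {e : ℤ ×ₗ ℤ} :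
    e ∈ torusEdges R ↔ (ofLex e).1 ∈ Finset.Ico (-2 * R : ℤ) (2 * R) ∧
      (ofLex e).2 - (ofLex e).1 ∈ Finset.Icc (-R : ℤ) R := by
  simp only [torusEdges, Finset.mem_map, Finset.mem_product]
  constructor
  · rintro ⟨q, ⟨h1, h2⟩, rfl⟩
    change q.1 ∈ _ ∧ q.1 + q.2 - q.1 ∈ _
    rw [add_sub_cancel_left]
    exact ⟨h1, h2⟩
  · rintro ⟨h1, h2⟩
    refine ⟨((ofLex e).1, (ofLex e).2 - (ofLex e).1), ⟨h1, h2⟩, ?_⟩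
    change toLex ((ofLex e).1, (ofLex e).1 + ((ofLex e).2 - (ofLex e).1)) = e
    rw [add_sub_cancel]
    rfl

/-- The jump attempt along an ordered pair of sites, with the target wrapped around. -/
def torusAttempt (R : ℕ) (e : ℤ ×ₗ ℤ) (η : Config) : Config :=
  attempt (ofLex e).1 (wrap R (ofLex e).2) η

theorem eventually_looksLikeExclusion_torus (i j : ℤ) :
    ∀ᶠ R : ℕ in atTop, LooksLikeExclusion (torusAttempt R) (torusEdges R) i j := by
  filter_upwards [eventually_gt_atTop (i.natAbs + j.natAbs)] with R hR
  have hR0 : 0 < R := by omega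
  refine ⟨fun e he => ?_, fun e he => ?_, fun e he heW hci hcj η z hz => ?_⟩
  · rw [mem_windowEdges, mem_Ico, mem_Ico] at he
    rw [mem_torusEdges, Finset.mem_Ico, Finset.mem_Icc]
    omega
  · rw [mem_windowEdges, mem_Ico, mem_Ico] at he
    funext η
    rw [torusAttempt, attemptEdge, wrap_of_mem (by rw [Finset.mem_Ico]; omega)]
  · rw [mem_windowEdges, mem_Ico, mem_Ico] at heW
    rw [mem_Ico] at hz
    rw [mem_torusEdges, Finset.mem_Ico, Finset.mem_Icc] at he
    simp only [crossingEdges, mem_ofPred_eq] at hci hcj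
    refine attempt_apply_of_ne (by omega) (fun hzy => ?_) η
    -- a target that is wrapped around lands at distance at least `R` from the origin
    have hwrap : wrap R (ofLex e).2 = (ofLex e).2 := by
      have h1 := Int.emod_add_mul_ediv ((ofLex e).2 + 2 * R) (4 * R)
      set q := ((ofLex e).2 + 2 * R) / (4 * R : ℤ) with hq
      have h2 : (ofLex e).2 = z + 4 * R * q := by
        rw [hzy, wrap]; linarith
      have hq0 : q = 0 := by
        rcases lt_trichotomy q 0 with h | h | h
        · have : (4 * R : ℤ) * q ≤ 4 * R * (-1) := by
            refine mul_le_mul_of_nonneg_left (by omega) (by omega)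
          omega
        · exact h
        · have : (4 * R : ℤ) * 1 ≤ 4 * R * q := by
            refine mul_le_mul_of_nonneg_left (by omega) (by omega)
          omega
      rw [hq0, mul_zero, add_zero] at h2
      rw [← hzy, h2]
    rw [hwrap] at hzy
    omega

end Exclusion

/-! ### Invariance of product measures -/

namespace Exclusion

open Filter Topology BoundedContinuousFunction

/-- The Bernoulli product measure of density `ρ`, as the law of `x ↦ 1{U x ≤ ρ}` for i.i.d. uniform
`U x`. -/
noncomputable def bernoulliProduct (ρ : ℝ) : Measure Config :=
  (Measure.infinitePi fun _ : ℤ => (volume : Measure unitInterval)).map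
    fun U x => decide ((U x : ℝ) ≤ ρ)

theorem measurable_threshold (ρ : ℝ) :
    Measurable fun (U : ℤ → unitInterval) (x : ℤ) => decide ((U x : ℝ) ≤ ρ) := by
  refine measurable_pi_lambda _ fun x => ?_
  refine measurable_to_bool ?_
  have h : (fun U : ℤ → unitInterval => decide ((U x : ℝ) ≤ ρ)) ⁻¹' {true} =
      {U | (U x : ℝ) ≤ ρ} := by ext; simp
  rw [h]
  exact measurableSet_le (measurable_subtype_coe.comp (measurable_pi_apply x)) measurable_const

instance (ρ : ℝ) : IsProbabilityMeasure (bernoulliProduct ρ) :=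
  Measure.isProbabilityMeasure_map (measurable_threshold ρ).aemeasurable

theorem bernoulliProduct_cylinder {ρ : ℝ} (hρ : ρ ∈ Set.Icc (0 : ℝ) 1) (A : Finset ℤ) :
    bernoulliProduct ρ {η | ∀ x ∈ A, η x = true} = ENNReal.ofReal (ρ ^ A.card) := by
  have hm : MeasurableSet {η : Config | ∀ x ∈ A, η x = true} := by
    have : {η : Config | ∀ x ∈ A, η x = true} = ⋂ x ∈ A, (fun η : Config => η x) ⁻¹' {true} := by
      ext; simp
    rw [this]
    exact Finset.measurableSet_biInter _ fun x _ =>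
      measurable_pi_apply x (measurableSet_singleton true)
  rw [bernoulliProduct, Measure.map_apply (measurable_threshold ρ) hm]
  have h1 : (fun (U : ℤ → unitInterval) (x : ℤ) => decide ((U x : ℝ) ≤ ρ)) ⁻¹'
      {η | ∀ x ∈ A, η x = true} = Set.pi A fun _ => Set.Iic (⟨ρ, hρ⟩ : unitInterval) := by
    ext U
    simp [Set.mem_pi, ← Subtype.coe_le_coe]
  rw [h1, Measure.infinitePi_pi _ fun _ _ => measurableSet_Iic, Finset.prod_const,
    unitInterval.volume_Iic, ENNReal.ofReal_pow hρ.1]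

/-- Exchanging the values at two sites. -/
def swapSites (x y : ℤ) (η : Config) : Config := fun z => η (Equiv.swap x y z)

theorem measurable_swapSites (x y : ℤ) : Measurable (swapSites x y) :=
  measurable_pi_lambda _ fun _ => measurable_pi_apply _

theorem map_swapSites (ρ : ℝ) (x y : ℤ) :
    (bernoulliProduct ρ).map (swapSites x y) = bernoulliProduct ρ := by
  have h1 := Measure.infinitePi_map_piCongrLeft
    (fun _ : ℤ => (volume : Measure unitInterval)) (Equiv.swap x y)
  have h2 : ∀ U : ℤ → unitInterval, MeasurableEquiv.piCongrLeft (fun _ : ℤ => unitInterval)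
      (Equiv.swap x y) U = fun z => U (Equiv.swap x y z) := by
    intro U
    funext z
    have := Equiv.piCongrLeft_apply_apply (P := fun _ : ℤ => unitInterval) (Equiv.swap x y) U
      (Equiv.swap x y z)
    rw [Equiv.swap_apply_self] at this
    exact this
  rw [bernoulliProduct, Measure.map_map (measurable_swapSites x y) (measurable_threshold ρ)]
  conv_rhs => rw [← h1]
  rw [Measure.map_map (measurable_threshold ρ) (MeasurableEquiv.measurable _)]
  congr 1
  funext U z
  simp only [Function.comp, h2, swapSites]

/-- A jump attempt from `x` to `y` changes the expectation under an exchangeable measure by the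
difference of the expectations restricted to `y` occupied and to `x` occupied. -/
theorem integral_attempt_sub {ν : Measure Config} [IsProbabilityMeasure ν] (x y : ℤ)
    (hν : ν.map (swapSites x y) = ν) (f : Config →ᵇ ℝ) :
    ∫ η, f (attempt x y η) ∂ν - ∫ η, f η ∂ν =
      ∫ η, (if η y then f η else 0) ∂ν - ∫ η, (if η x then f η else 0) ∂ν := by
  have hocc : ∀ z, MeasurableSet {η : Config | η z = true} := fun z =>
    measurable_pi_apply (X := fun _ : ℤ => Bool) z (measurableSet_singleton true)
  have hfm : Measurable f := f.continuous.measurable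
  have hint : ∀ g : Config → ℝ, Measurable g → (∀ η, |g η| ≤ ‖f‖) → Integrable g ν := fun g hg hb =>
    Integrable.of_bound hg.aestronglyMeasurable ‖f‖ (Eventually.of_forall hb)
  set G : Config → ℝ := fun η => if η y then (if η x then 0 else f η) else 0 with hG
  have hGm : Measurable G :=
    Measurable.ite (hocc y) (Measurable.ite (hocc x) measurable_const hfm) measurable_const
  have hb : ∀ η, |f η| ≤ ‖f‖ := fun η => f.norm_coe_le_norm η
  have hGb : ∀ η, |G η| ≤ ‖f‖ := fun η => by
    simp only [hG]; split_ifs <;> simp [hb η]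
  have hGs : ∫ η, G (swapSites x y η) ∂ν = ∫ η, G η ∂ν := by
    conv_rhs => rw [← hν]
    rw [integral_map (measurable_swapSites x y).aemeasurable hGm.aestronglyMeasurable]
  have hswap : ∀ η : Config, η x = true → η y = false → attempt x y η = swapSites x y η := by
    intro η hx hy
    funext z
    rw [attempt_apply, swapSites]
    by_cases hzy : z = y
    · subst hzy; simp [hx]
    · by_cases hzx : z = x
      · subst hzx; simp [hzy, hy]
      · simp [hzx, hzy, Equiv.swap_apply_of_ne_of_ne hzx hzy]
  have hstay : ∀ η : Config, ¬ (η x = true ∧ η y = false) → attempt x y η = η := by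
    intro η h
    rw [attempt, if_neg h]
  have hpt : ∀ η, f (attempt x y η) = f η + G (swapSites x y η) - G η +
      ((if η y then f η else 0) - (if η x then f η else 0)) := by
    intro η
    have hGs' : G (swapSites x y η) =
        if η x then (if η y then 0 else f (swapSites x y η)) else 0 := by
      simp [hG, swapSites]
    rw [hGs']
    simp only [hG]
    cases hx : η x <;> cases hy : η y
    · rw [hstay η (by simp [hx])]; simp
    · rw [hstay η (by simp [hx])]; simp
    · rw [hswap η hx hy]; simp
    · rw [hstay η (by simp [hy])]; simp
  have hiG := hint G hGm hGb
  have hiGs := hint (fun η => G (swapSites x y η)) (hGm.comp (measurable_swapSites x y))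
    fun η => hGb _
  have hif := hint f hfm hb
  have hiz : ∀ z, Integrable (fun η : Config => if η z then f η else 0) ν := fun z =>
    hint _ (Measurable.ite (hocc z) hfm measurable_const) fun η => by
      split_ifs <;> simp [hb η]
  have e1 : ∫ η, f (attempt x y η) ∂ν =
      ∫ η, (f η + G (swapSites x y η) - G η) ∂ν +
        ∫ η, ((if η y then f η else 0) - (if η x then f η else 0)) ∂ν :=
    (integral_congr_ae (Eventually.of_forall hpt)).trans
      (integral_add ((hif.add hiGs).sub hiG) ((hiz y).sub (hiz x)))
  have e2 : ∫ η, (f η + G (swapSites x y η) - G η) ∂ν =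
      ∫ η, (f η + G (swapSites x y η)) ∂ν - ∫ η, G η ∂ν := integral_sub (hif.add hiGs) hiG
  have e3 : ∫ η, (f η + G (swapSites x y η)) ∂ν = ∫ η, f η ∂ν + ∫ η, G (swapSites x y η) ∂ν :=
    integral_add hif hiGs
  rw [e1, e2, e3, hGs, integral_sub (hiz y) (hiz x)]
  ring

/-- If a functional vanishes on the range of `L`, it is invariant under `exp (t L)`. -/
theorem apply_exp_smul_eq {E : Type*} [NormedAddCommGroup E] [NormedSpace ℝ E] [CompleteSpace E]
    (L : E →L[ℝ] E) (φ : E →L[ℝ] ℝ) (h : ∀ f, φ (L f) = 0) (t : ℝ) (f : E) :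
    φ (NormedSpace.exp (t • L) f) = φ f := by
  have hd : ∀ s : ℝ, HasDerivAt (fun u : ℝ => φ (NormedSpace.exp (u • L) f)) 0 s := by
    intro s
    have h1 := hasDerivAt_exp_smul_const' (𝕂 := ℝ) L s
    have h2 := (φ.comp (ContinuousLinearMap.apply ℝ E f)).hasFDerivAt.comp_hasDerivAt s h1
    have h3 : (φ.comp (ContinuousLinearMap.apply ℝ E f)) (L * NormedSpace.exp (s • L)) = 0 :=
      h _
    rw [h3] at h2
    exact h2
  have h4 := is_const_of_deriv_eq_zero (fun s => (hd s).differentiableAt) (fun s => (hd s).deriv)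
    t 0
  simpa using h4

/-- The generator of the periodic system is stationary for the product measures: each site of the
torus is entered and left at the same rate. -/
theorem integral_finGen_torus {p : ℤ → ℤ → ℝ≥0} (hp_transl : ∀ x y, p x y = p 0 (y - x))
    {R : ℕ} (hR : 0 < R) (a : ℤ ×ₗ ℤ → C(Config, Config)) (ha : ∀ e, ⇑(a e) = torusAttempt R e)
    (ρ : ℝ) (f : Config →ᵇ ℝ) :
    ∫ η, finGen a (fun e => p (ofLex e).1 (ofLex e).2) (torusEdges R) f η
      ∂(bernoulliProduct ρ) = 0 := by
  set ν := bernoulliProduct ρ with hν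
  set g : ℤ → ℝ := fun v => ∫ η, (if η v then f η else 0) ∂ν with hg
  have hint : ∀ F : Config →ᵇ ℝ, Integrable F ν := fun F => F.integrable ν
  have h1 : ∀ η, finGen a (fun e => p (ofLex e).1 (ofLex e).2) (torusEdges R) f η =
      ∑ e ∈ torusEdges R, (p (ofLex e).1 (ofLex e).2 : ℝ) * (koopman (a e) f η - f η) := by
    intro η
    simp [finGen]
  simp_rw [h1]
  rw [integral_finsetSum (torusEdges R)
    (f := fun e η => (p (ofLex e).1 (ofLex e).2 : ℝ) * (koopman (a e) f η - f η))
    fun e _ => ((hint (koopman (a e) f)).sub (hint f)).const_mul _]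
  have h2 : ∀ e ∈ torusEdges R,
      ∫ η, (p (ofLex e).1 (ofLex e).2 : ℝ) * (koopman (a e) f η - f η) ∂ν =
      (p 0 ((ofLex e).2 - (ofLex e).1) : ℝ) * (g (wrap R (ofLex e).2) - g (ofLex e).1) := by
    intro e _
    rw [integral_const_mul, integral_sub (hint _) (hint _), ← hp_transl]
    congr 1
    simp only [koopman_apply, ha, torusAttempt]
    exact integral_attempt_sub _ _ (map_swapSites ρ _ _) f
  rw [Finset.sum_congr rfl h2, torusEdges, Finset.sum_map, Finset.sum_product_right]
  refine Finset.sum_eq_zero fun d _ => ?_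
  have h3 : ∀ x : ℤ, (p 0 ((x + d) - x) : ℝ) * (g (wrap R (x + d)) - g x) =
      (p 0 d : ℝ) * (g (wrap R (x + d)) - g x) := fun x => by rw [add_sub_cancel_left]
  refine (Finset.sum_congr rfl fun x _ => h3 x).trans ?_
  rw [← Finset.mul_sum, Finset.sum_sub_distrib, sum_wrap_add hR, sub_self, mul_zero]

section

variable {Ω : Type*} [MeasurableSpace Ω] {P : Measure Ω}
  {p : ℤ → ℤ → ℝ≥0} {N : ℤ → ℤ → ℝ≥0 → Ω → ℕ}

theorem isPoissonProcess_edge (hN : IsPoissonFamily P p N) (e : ℤ ×ₗ ℤ) :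
    IsPoissonProcess P (p (ofLex e).1 (ofLex e).2) (N (ofLex e).1 (ofLex e).2) :=
  hN.poisson _ _

theorem iIndepFun_edge (hN : IsPoissonFamily P p N) :
    iIndepFun (fun (e : ℤ ×ₗ ℤ) ω t => N (ofLex e).1 (ofLex e).2 t ω) P :=
  hN.indep.precomp (g := fun e : ℤ ×ₗ ℤ => ofLex e) ofLex.injective

variable [IsProbabilityMeasure P]

/-- For almost every realization, finite systems that look like the exclusion process converge
to it. -/
theorem ae_tendsto_finFlow_evolve (hp_transl : ∀ x y, p x y = p 0 (y - x))
    (hp_moment : Summable fun x : ℤ => |(x : ℝ)| * (p 0 x : ℝ))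
    (hN : IsPoissonFamily P p N) (t : ℝ≥0)
    {act : ℕ → ℤ ×ₗ ℤ → Config → Config} {K : ℕ → Finset (ℤ ×ₗ ℤ)}
    (hact : ∀ i j, ∀ᶠ R in atTop, LooksLikeExclusion (act R) (K R) i j) :
    ∀ᵐ ω ∂P, ∀ (η : ℕ → Config) (η₀ : Config), Tendsto η atTop (𝓝 η₀) →
      Tendsto (fun R => finFlow (act R) (fun e s => N (ofLex e).1 (ofLex e).2 s ω) (K R) t (η R))
        atTop (𝓝 (evolve (fun x y s => N x y s ω) t η₀)) := by
  filter_upwards [ae_exists_noCrossing hp_transl hp_moment hN t] with ω hω η η₀ hη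
  exact tendsto_finFlow_evolve (n := fun x y s => N x y s ω)
    (fun x y => (hN.poisson x y).mono ω) hω hact hη

theorem ae_continuous_evolve (hp_transl : ∀ x y, p x y = p 0 (y - x))
    (hp_moment : Summable fun x : ℤ => |(x : ℝ)| * (p 0 x : ℝ))
    (hN : IsPoissonFamily P p N) (t : ℝ≥0) :
    ∀ᵐ ω ∂P, Continuous (evolve (fun x y s => N x y s ω) t) := by
  filter_upwards [ae_exists_noCrossing hp_transl hp_moment hN t] with ω hω
  exact continuous_evolve (n := fun x y s => N x y s ω)
    (fun x y => (hN.poisson x y).mono ω) hω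

/-- The jump attempts as continuous maps. -/
noncomputable def attemptMap (e : ℤ ×ₗ ℤ) : C(Config, Config) :=
  ⟨attemptEdge e, continuous_attempt _ _⟩

theorem eventually_looksLikeExclusion_window (i j : ℤ) :
    ∀ᶠ R : ℕ in atTop, LooksLikeExclusion attemptEdge (windowEdges (-(R : ℤ)) R) i j := by
  filter_upwards [eventually_ge_atTop (i.natAbs + j.natAbs)] with R hR
  exact looksLikeExclusion_windowEdges (by omega) (by omega)

theorem aemeasurable_evolve (hp_transl : ∀ x y, p x y = p 0 (y - x))
    (hp_moment : Summable fun x : ℤ => |(x : ℝ)| * (p 0 x : ℝ))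
    (hN : IsPoissonFamily P p N) (t : ℝ≥0) {E : Type*} [MeasurableSpace E] {m : Measure E}
    {Z : E → Config} (hZ : Measurable Z) {W : E → Ω} (hW : Measure.QuasiMeasurePreserving W m P) :
    AEMeasurable (fun q => evolve (fun x y s => N x y s (W q)) t (Z q)) m := by
  refine aemeasurable_of_tendsto_metrizable_ae atTop
    (fun R : ℕ => ((measurable_finFlow (isPoissonProcess_edge hN) attemptMap
      (windowEdges (-(R : ℤ)) R) t).comp (hZ.prodMk hW.measurable)).aemeasurable) ?_
  filter_upwards [hW.ae (ae_tendsto_finFlow_evolve hp_transl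
    hp_moment hN t (act := fun _ => attemptEdge) (K := fun R => windowEdges (-(R : ℤ)) R)
    eventually_looksLikeExclusion_window)] with q hq
  exact hq (fun _ => Z q) (Z q) tendsto_const_nhds

theorem continuous_integral_evolve (hp_transl : ∀ x y, p x y = p 0 (y - x))
    (hp_moment : Summable fun x : ℤ => |(x : ℝ)| * (p 0 x : ℝ))
    (hN : IsPoissonFamily P p N) (t : ℝ≥0) (f : Config →ᵇ ℝ) :
    Continuous fun η => ∫ ω, f (evolve (fun x y s => N x y s ω) t η) ∂P := by
  refine continuous_of_dominated (bound := fun _ => ‖f‖) (fun η => ?_)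
    (fun η => Eventually.of_forall fun ω => f.norm_coe_le_norm _) (integrable_const _) ?_
  · have h2 := aemeasurable_evolve hp_transl hp_moment hN t
      (measurable_const (a := η)) (Measure.QuasiMeasurePreserving.id P)
    exact (f.continuous.measurable.comp_aemeasurable h2).aestronglyMeasurable
  · filter_upwards [ae_continuous_evolve hp_transl hp_moment hN t] with ω hω
    exact f.continuous.comp hω

/-- The Bernoulli product measures are invariant for the exclusion process: they are invariant for
the periodic systems, which converge to it. -/
theorem integral_evolve_bernoulliProduct (hp_transl : ∀ x y, p x y = p 0 (y - x))
    (hp_moment : Summable fun x : ℤ => |(x : ℝ)| * (p 0 x : ℝ))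
    (hN : IsPoissonFamily P p N) (t : ℝ≥0) (ρ : ℝ) (f : Config →ᵇ ℝ) :
    ∫ η, ∫ ω, f (evolve (fun x y s => N x y s ω) t η) ∂P ∂(bernoulliProduct ρ) =
      ∫ η, f η ∂(bernoulliProduct ρ) := by
  set ν := bernoulliProduct ρ with hν
  set a : ℕ → ℤ ×ₗ ℤ → C(Config, Config) := fun R e =>
    ⟨torusAttempt R e, continuous_attempt _ _⟩ with ha
  have hc := isPoissonProcess_edge hN
  set F : ℕ → Config → Ω → ℝ := fun R η ω =>
    f (finFlow (fun e => ⇑(a R e)) (fun e s => N (ofLex e).1 (ofLex e).2 s ω) (torusEdges R) t η)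
    with hF
  have hFm : ∀ R, Measurable fun q : Config × Ω => F R q.1 q.2 := fun R =>
    f.continuous.measurable.comp (measurable_finFlow hc (a R) (torusEdges R) t)
  have hFb : ∀ R η ω, ‖F R η ω‖ ≤ ‖f‖ := fun R η ω => f.norm_coe_le_norm _
  have h1 : ∀ η, Tendsto (fun R => ∫ ω, F R η ω ∂P) atTop
      (𝓝 (∫ ω, f (evolve (fun x y s => N x y s ω) t η) ∂P)) := by
    intro η
    refine tendsto_integral_of_dominated_convergence (fun _ => ‖f‖)
      (fun R => ((hFm R).comp measurable_prodMk_left).aestronglyMeasurable)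
      (integrable_const _) (fun R => Eventually.of_forall fun ω => hFb R η ω) ?_
    filter_upwards [ae_tendsto_finFlow_evolve hp_transl hp_moment hN t
      eventually_looksLikeExclusion_torus] with ω hω
    exact (f.continuous.tendsto _).comp (hω (fun _ => η) η tendsto_const_nhds)
  have h2 : Tendsto (fun R => ∫ η, ∫ ω, F R η ω ∂P ∂ν) atTop
      (𝓝 (∫ η, ∫ ω, f (evolve (fun x y s => N x y s ω) t η) ∂P ∂ν)) := by
    refine tendsto_integral_of_dominated_convergence (fun _ => ‖f‖) (fun R => ?_)
      (integrable_const _) (fun R => Eventually.of_forall fun η => ?_)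
      (Eventually.of_forall h1)
    · exact (hFm R).stronglyMeasurable.integral_prod_right.aestronglyMeasurable
    · refine (norm_integral_le_of_norm_le_const (Eventually.of_forall (hFb R η))).trans ?_
      simp
  have h3 : ∀ᶠ R : ℕ in atTop, ∫ η, ∫ ω, F R η ω ∂P ∂ν = ∫ η, f η ∂ν := by
    filter_upwards [eventually_gt_atTop 0] with R hR
    simp only [hF, integral_finFlow hc (iIndepFun_edge hN) (a R) (torusEdges R) t f]
    set φ : (Config →ᵇ ℝ) →L[ℝ] ℝ := LinearMap.mkContinuous
      { toFun := fun g => ∫ η, g η ∂ν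
        map_add' := fun g h => integral_add (g.integrable ν) (h.integrable ν)
        map_smul' := fun c g => integral_const_mul c _ } 1 (fun g => by
          rw [one_mul]
          exact (norm_integral_le_of_norm_le_const
            (Eventually.of_forall g.norm_coe_le_norm)).trans (by simp)) with hφ
    exact apply_exp_smul_eq (E := Config →ᵇ ℝ) _ φ
      (fun g => integral_finGen_torus hp_transl hR (a R) (fun _ => rfl) ρ g) t f
  exact tendsto_nhds_unique h2 (tendsto_nhds_of_eventually_eq h3)

end

end Exclusion

/-! ### The transition semigroup of the coupled process -/

namespace Exclusion

open Filter Topology BoundedContinuousFunction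

section

variable {Ω : Type*} [MeasurableSpace Ω] {P : Measure Ω}
  {p : ℤ → ℤ → ℝ≥0} {N : ℤ → ℤ → ℝ≥0 → Ω → ℕ}

/-- The jump attempts, carried out in both components. -/
noncomputable def pairAttempt (e : ℤ ×ₗ ℤ) : C(Config × Config, Config × Config) :=
  (attemptMap e).prodMap (attemptMap e)

theorem finFlow_pairAttempt (c : ℤ ×ₗ ℤ → ℝ≥0 → ℕ) (K : Finset (ℤ ×ₗ ℤ)) (t : ℝ≥0)
    (ζ : Config × Config) :
    finFlow (fun e => ⇑(pairAttempt e)) c K t ζ =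
      (finFlow attemptEdge c K t ζ.1, finFlow attemptEdge c K t ζ.2) := by
  unfold finFlow
  generalize jumpList c K 0 t = l
  induction l generalizing ζ with
  | nil => rfl
  | cons e l ih => exact ih (pairAttempt e ζ)

/-- The coupled finite system in the window `[-R, R)`. -/
noncomputable def windowPair (N : ℤ → ℤ → ℝ≥0 → Ω → ℕ) (R : ℕ) (t : ℝ≥0)
    (ζ : Config × Config) (ω : Ω) : Config × Config :=
  finFlow (fun e => ⇑(pairAttempt e)) (fun e s => N (ofLex e).1 (ofLex e).2 s ω)
    (windowEdges (-(R : ℤ)) R) t ζ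

/-- The transition operator of the coupled finite system in the window `[-R, R)`. -/
noncomputable def windowOp (p : ℤ → ℤ → ℝ≥0) (R : ℕ) (t : ℝ≥0) :
    BoundedOp (Config × Config →ᵇ ℝ) :=
  NormedSpace.exp ((t : ℝ) • finGen pairAttempt (fun e => p (ofLex e).1 (ofLex e).2)
    (windowEdges (-(R : ℤ)) R))

theorem measurable_windowPair (hN : IsPoissonFamily P p N) (R : ℕ) (t : ℝ≥0)
    (ζ : Config × Config) : Measurable fun ω => windowPair N R t ζ ω :=
  (measurable_finFlow (isPoissonProcess_edge hN) pairAttempt (windowEdges (-(R : ℤ)) R) t).comp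
    measurable_prodMk_left

variable [IsProbabilityMeasure P]

theorem aemeasurable_coupled (hp_transl : ∀ x y, p x y = p 0 (y - x))
    (hp_moment : Summable fun x : ℤ => |(x : ℝ)| * (p 0 x : ℝ))
    (hN : IsPoissonFamily P p N) (t : ℝ≥0) {E : Type*} [MeasurableSpace E] {m : Measure E}
    {Z : E → Config × Config} (hZ : Measurable Z) {W : E → Ω}
    (hW : Measure.QuasiMeasurePreserving W m P) :
    AEMeasurable (fun q => coupled N t (Z q) (W q)) m :=
  (aemeasurable_evolve hp_transl hp_moment hN t (measurable_fst.comp hZ) hW).prodMk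
    (aemeasurable_evolve hp_transl hp_moment hN t (measurable_snd.comp hZ) hW)

theorem aestronglyMeasurable_coupled (hp_transl : ∀ x y, p x y = p 0 (y - x))
    (hp_moment : Summable fun x : ℤ => |(x : ℝ)| * (p 0 x : ℝ))
    (hN : IsPoissonFamily P p N) (t : ℝ≥0) (f : Config × Config →ᵇ ℝ) (ζ : Config × Config) :
    AEStronglyMeasurable (fun ω => f (coupled N t ζ ω)) P :=
  (f.continuous.measurable.comp_aemeasurable (aemeasurable_coupled hp_transl hp_moment hN t
    (measurable_const (a := ζ)) (Measure.QuasiMeasurePreserving.id P))).aestronglyMeasurable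

/-- The transition operator `f ↦ E f(σ_t, θ_t)` of the coupled process on continuous functions. -/
noncomputable def transOp (hp_transl : ∀ x y, p x y = p 0 (y - x))
    (hp_moment : Summable fun x : ℤ => |(x : ℝ)| * (p 0 x : ℝ))
    (hN : IsPoissonFamily P p N) (t : ℝ≥0) (f : Config × Config →ᵇ ℝ) : Config × Config →ᵇ ℝ :=
  BoundedContinuousFunction.mkOfCompact ⟨fun ζ => ∫ ω, f (coupled N t ζ ω) ∂P, by
    refine continuous_of_dominated (bound := fun _ => ‖f‖)
      (fun ζ => aestronglyMeasurable_coupled hp_transl hp_moment hN t f ζ)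
      (fun ζ => Eventually.of_forall fun ω => f.norm_coe_le_norm _) (integrable_const _) ?_
    filter_upwards [ae_continuous_evolve hp_transl hp_moment hN t] with ω hω
    exact f.continuous.comp ((hω.comp continuous_fst).prodMk (hω.comp continuous_snd))⟩

theorem transOp_apply (hp_transl : ∀ x y, p x y = p 0 (y - x))
    (hp_moment : Summable fun x : ℤ => |(x : ℝ)| * (p 0 x : ℝ))
    (hN : IsPoissonFamily P p N) (t : ℝ≥0) (f : Config × Config →ᵇ ℝ) (ζ : Config × Config) :
    transOp hp_transl hp_moment hN t f ζ = ∫ ω, f (coupled N t ζ ω) ∂P := rfl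

theorem windowOp_apply (hN : IsPoissonFamily P p N) (R : ℕ) (t : ℝ≥0)
    (f : Config × Config →ᵇ ℝ) (ζ : Config × Config) :
    windowOp p R t f ζ = ∫ ω, f (windowPair N R t ζ ω) ∂P :=
  (integral_finFlow (isPoissonProcess_edge hN) (iIndepFun_edge hN) pairAttempt
    (windowEdges (-(R : ℤ)) R) t f ζ).symm

theorem ae_tendsto_windowPair (hp_transl : ∀ x y, p x y = p 0 (y - x))
    (hp_moment : Summable fun x : ℤ => |(x : ℝ)| * (p 0 x : ℝ))
    (hN : IsPoissonFamily P p N) (t : ℝ≥0) :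
    ∀ᵐ ω ∂P, ∀ (ζ : ℕ → Config × Config) (ζ₀ : Config × Config), Tendsto ζ atTop (𝓝 ζ₀) →
      Tendsto (fun R => windowPair N R t (ζ R) ω) atTop (𝓝 (coupled N t ζ₀ ω)) := by
  filter_upwards [ae_tendsto_finFlow_evolve hp_transl hp_moment hN t
    (act := fun _ => attemptEdge) (K := fun R => windowEdges (-(R : ℤ)) R)
    eventually_looksLikeExclusion_window] with ω hω ζ ζ₀ hζ
  simp only [windowPair, finFlow_pairAttempt]
  exact (hω _ _ ((continuous_fst.tendsto ζ₀).comp hζ)).prodMk_nhds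
    (hω _ _ ((continuous_snd.tendsto ζ₀).comp hζ))

/-- The window semigroups converge to the transition operators, also along converging initial
configurations. -/
theorem tendsto_windowOp (hp_transl : ∀ x y, p x y = p 0 (y - x))
    (hp_moment : Summable fun x : ℤ => |(x : ℝ)| * (p 0 x : ℝ))
    (hN : IsPoissonFamily P p N) (t : ℝ≥0) (f : Config × Config →ᵇ ℝ)
    {ζ : ℕ → Config × Config} {ζ₀ : Config × Config} (hζ : Tendsto ζ atTop (𝓝 ζ₀)) :
    Tendsto (fun R => windowOp p R t f (ζ R)) atTop
      (𝓝 (transOp hp_transl hp_moment hN t f ζ₀)) := by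
  simp only [windowOp_apply hN, transOp_apply]
  refine tendsto_integral_of_dominated_convergence (fun _ => ‖f‖)
    (fun R => (f.continuous.measurable.comp (measurable_windowPair hN R t _)).aestronglyMeasurable)
    (integrable_const _) (fun R => Eventually.of_forall fun ω => f.norm_coe_le_norm _) ?_
  filter_upwards [ae_tendsto_windowPair hp_transl hp_moment hN t] with ω hω
  exact (f.continuous.tendsto _).comp (hω ζ ζ₀ hζ)

theorem norm_windowOp_apply_le (hN : IsPoissonFamily P p N) (R : ℕ) (t : ℝ≥0)
    (f : Config × Config →ᵇ ℝ) (ζ : Config × Config) : ‖windowOp p R t f ζ‖ ≤ ‖f‖ := by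
  rw [windowOp_apply hN]
  exact (norm_integral_le_of_norm_le_const (Eventually.of_forall
    fun ω => f.norm_coe_le_norm _)).trans (by simp)

/-- The transition operators form a semigroup, as limits of the exponential semigroups of the
windows. -/
theorem transOp_add (hp_transl : ∀ x y, p x y = p 0 (y - x))
    (hp_moment : Summable fun x : ℤ => |(x : ℝ)| * (p 0 x : ℝ))
    (hN : IsPoissonFamily P p N) (s t : ℝ≥0) (f : Config × Config →ᵇ ℝ) :
    transOp hp_transl hp_moment hN (s + t) f =
      transOp hp_transl hp_moment hN s (transOp hp_transl hp_moment hN t f) := by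
  ext ζ
  have h1 := tendsto_windowOp hp_transl hp_moment hN (s + t) f
    (tendsto_const_nhds (x := ζ) (f := atTop))
  have h2 : ∀ R, windowOp p R (s + t) f ζ = ∫ ω, windowOp p R t f (windowPair N R s ζ ω) ∂P := by
    intro R
    rw [← windowOp_apply hN]
    have : windowOp p R (s + t) = windowOp p R s * windowOp p R t := by
      rw [windowOp, NNReal.coe_add]
      exact exp_add_smul (A := BoundedOp (Config × Config →ᵇ ℝ)) _ _ _
    rw [this]
    rfl
  simp only [h2] at h1
  refine tendsto_nhds_unique h1 ?_
  rw [transOp_apply]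
  refine tendsto_integral_of_dominated_convergence (fun _ => ‖f‖)
    (fun R => ((windowOp p R t f).continuous.measurable.comp
      (measurable_windowPair hN R s _)).aestronglyMeasurable)
    (integrable_const _)
    (fun R => Eventually.of_forall fun ω => norm_windowOp_apply_le hN R t f _) ?_
  filter_upwards [ae_tendsto_windowPair hp_transl hp_moment hN s] with ω hω
  exact tendsto_windowOp hp_transl hp_moment hN t f (hω _ ζ tendsto_const_nhds)

end

end Exclusion

/-! ### Common invariant measures of commuting Feller operators -/

namespace Exclusion

open Filter Topology BoundedContinuousFunction

section

variable {X : Type*} [MeasurableSpace X]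

/-- The average of the first `n + 1` measures of a sequence. -/
noncomputable def averageMeasure (μ : ℕ → ProbabilityMeasure X) (n : ℕ) : ProbabilityMeasure X :=
  ⟨((n : ℝ≥0∞) + 1)⁻¹ • ∑ k ∈ Finset.range (n + 1), (μ k : Measure X), ⟨by
    simp only [Measure.smul_apply, Measure.coe_finsetSum, Finset.sum_apply, measure_univ,
      Finset.sum_const, Finset.card_range, nsmul_eq_mul, mul_one, smul_eq_mul]
    push_cast
    exact ENNReal.inv_mul_cancel (by simp) (by finiteness)⟩⟩

theorem averageMeasure_apply (μ : ℕ → ProbabilityMeasure X) (n : ℕ) (s : Set X) :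
    (averageMeasure μ n : Measure X) s =
      ((n : ℝ≥0∞) + 1)⁻¹ * ∑ k ∈ Finset.range (n + 1), (μ k : Measure X) s := by
  simp only [averageMeasure, ProbabilityMeasure.coe_mk, Measure.smul_apply, smul_eq_mul,
    Measure.coe_finsetSum, Finset.sum_apply]

theorem averageMeasure_apply_eq {μ : ℕ → ProbabilityMeasure X} {s : Set X} {c : ℝ≥0∞}
    (h : ∀ k, (μ k : Measure X) s = c) (n : ℕ) : (averageMeasure μ n : Measure X) s = c := by
  rw [averageMeasure_apply]
  simp only [h, Finset.sum_const, Finset.card_range, nsmul_eq_mul]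
  push_cast
  rw [← mul_assoc, ENNReal.inv_mul_cancel (by simp) (by finiteness), one_mul]

variable [TopologicalSpace X] [BorelSpace X]

theorem integral_averageMeasure (μ : ℕ → ProbabilityMeasure X) (n : ℕ) (f : X →ᵇ ℝ) :
    ∫ x, f x ∂(averageMeasure μ n : Measure X) =
      ((n : ℝ) + 1)⁻¹ * ∑ k ∈ Finset.range (n + 1), ∫ x, f x ∂(μ k : Measure X) := by
  simp only [averageMeasure, ProbabilityMeasure.coe_mk]
  rw [integral_smul_measure, integral_finsetSum_measure fun k _ => f.integrable _, smul_eq_mul]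
  congr 1
  rw [ENNReal.toReal_inv, ENNReal.toReal_add (by finiteness) (by finiteness)]
  simp

theorem continuous_of_integral_eq {T : ProbabilityMeasure X → ProbabilityMeasure X}
    {S : (X →ᵇ ℝ) → (X →ᵇ ℝ)}
    (h : ∀ μ f, ∫ x, f x ∂(T μ : Measure X) = ∫ x, S f x ∂(μ : Measure X)) : Continuous T := by
  rw [continuous_iff_continuousAt]
  intro μ
  rw [ContinuousAt, ProbabilityMeasure.tendsto_iff_forall_integral_tendsto]
  intro f
  simp only [h]
  exact (ProbabilityMeasure.tendsto_iff_forall_integral_tendsto.1 tendsto_id) (S f)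

variable [HasOuterApproxClosed X]

theorem probabilityMeasure_ext {μ ν : ProbabilityMeasure X}
    (h : ∀ f : X →ᵇ ℝ, ∫ x, f x ∂(μ : Measure X) = ∫ x, f x ∂(ν : Measure X)) : μ = ν :=
  Subtype.ext (ext_of_forall_integral_eq_of_IsFiniteMeasure
    (μ := (μ : Measure X)) (ν := (ν : Measure X)) h)

/-- A version of the Markov–Kakutani theorem: commuting Feller operators that preserve a nonempty
closed set of probability measures on a compact space, stable under averages, have a common
invariant measure in it. Limits of Cesàro averages give one operator after the other an
invariant measure, and compactness deals with infinitely many operators. -/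
theorem exists_common_invariant [CompactSpace X] [T2Space X] {ι : Type*}
    (T : ι → ProbabilityMeasure X → ProbabilityMeasure X) (S : ι → (X →ᵇ ℝ) → (X →ᵇ ℝ))
    (hTS : ∀ i μ f, ∫ x, f x ∂(T i μ : Measure X) = ∫ x, S i f x ∂(μ : Measure X))
    (hcomm : ∀ i j f, S i (S j f) = S j (S i f)) {C : Set (ProbabilityMeasure X)}
    (hC : IsClosed C) (hne : C.Nonempty) (hT : ∀ i, ∀ μ ∈ C, T i μ ∈ C)
    (hconv : ∀ μ : ℕ → ProbabilityMeasure X, (∀ k, μ k ∈ C) → ∀ n, averageMeasure μ n ∈ C) :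
    ∃ μ ∈ C, ∀ i, T i μ = μ := by
  classical
  have hTc : ∀ i, Continuous (T i) := fun i => continuous_of_integral_eq (hTS i)
  have hTcomm : ∀ i j μ, T i (T j μ) = T j (T i μ) := fun i j μ =>
    probabilityMeasure_ext fun f => by rw [hTS, hTS, hTS, hTS, hcomm]
  set D : Finset ι → Set (ProbabilityMeasure X) := fun F => {μ ∈ C | ∀ i ∈ F, T i μ = μ} with hD
  have hDclosed : ∀ F, IsClosed (D F) := by
    intro F
    have : D F = C ∩ ⋂ i ∈ F, {μ | T i μ = μ} := by
      ext μ; simp [hD]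
    rw [this]
    exact hC.inter (isClosed_biInter fun i _ => isClosed_eq (hTc i) continuous_id)
  have hDne : ∀ F, (D F).Nonempty := by
    intro F
    induction F using Finset.induction_on with
    | empty => obtain ⟨μ, hμ⟩ := hne; exact ⟨μ, hμ, by simp⟩
    | insert i F hi ih =>
      obtain ⟨μ₀, hμ₀C, hμ₀⟩ := ih
      set ν : ℕ → ProbabilityMeasure X := fun k => (T i)^[k] μ₀ with hν
      have hνC : ∀ k, ν k ∈ C := by
        intro k
        induction k with
        | zero => exact hμ₀C
        | succ k ihk => rw [hν]; simp only [Function.iterate_succ_apply']; exact hT i _ ihk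
      have hνF : ∀ j ∈ F, ∀ k, T j (ν k) = ν k := by
        intro j hj k
        induction k with
        | zero => exact hμ₀ j hj
        | succ k ihk =>
          simp only [hν, Function.iterate_succ_apply'] at ihk ⊢
          rw [hTcomm, ihk]
      have havg : ∀ n, averageMeasure ν n ∈ D F := by
        refine fun n => ⟨hconv ν hνC n, fun j hj => probabilityMeasure_ext fun f => ?_⟩
        rw [hTS, integral_averageMeasure, integral_averageMeasure]
        refine congrArg _ (Finset.sum_congr rfl fun k _ => ?_)
        rw [← hTS, hνF j hj k]
      obtain ⟨μ, hμ, hlim⟩ := (hDclosed F).isCompact.ultrafilter_le_nhds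
        ((Ultrafilter.of atTop).map (averageMeasure ν)) (by
          rw [le_principal_iff, Ultrafilter.mem_coe, Ultrafilter.mem_map]
          exact Eventually.of_forall havg)
      have hlim' : Tendsto (averageMeasure ν) ((Ultrafilter.of atTop : Ultrafilter ℕ) : Filter ℕ)
          (𝓝 μ) := hlim
      refine ⟨μ, hμ.1, fun j hj => ?_⟩
      rcases Finset.mem_insert.1 hj with rfl | hj
      · -- the integrals of `S f` and `f` against the averages differ by a telescoping sum
        refine probabilityMeasure_ext fun f => ?_
        rw [hTS]
        have h1 := ((ProbabilityMeasure.tendsto_iff_forall_integral_tendsto.1 hlim') (S j f)).sub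
          ((ProbabilityMeasure.tendsto_iff_forall_integral_tendsto.1 hlim') f)
        have h2 : ∀ n, ∫ x, S j f x ∂(averageMeasure ν n : Measure X) -
            ∫ x, f x ∂(averageMeasure ν n : Measure X) =
            ((n : ℝ) + 1)⁻¹ * (∫ x, f x ∂(ν (n + 1) : Measure X) -
              ∫ x, f x ∂(ν 0 : Measure X)) := by
          intro n
          rw [integral_averageMeasure, integral_averageMeasure, ← mul_sub,
            ← Finset.sum_sub_distrib, ← Finset.sum_range_sub fun k => ∫ x, f x ∂(ν k : Measure X)]
          refine congrArg _ (Finset.sum_congr rfl fun k _ => ?_)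
          rw [← hTS, hν]
          simp only [Function.iterate_succ_apply']
        have hb : ∀ k, |∫ x, f x ∂(ν k : Measure X)| ≤ ‖f‖ := fun k =>
          (norm_integral_le_of_norm_le_const (Eventually.of_forall f.norm_coe_le_norm)).trans
            (by simp)
        have h3 : Tendsto (fun n : ℕ => ((n : ℝ) + 1)⁻¹ * (∫ x, f x ∂(ν (n + 1) : Measure X) -
            ∫ x, f x ∂(ν 0 : Measure X))) atTop (𝓝 0) := by
          have h4 : Tendsto (fun n : ℕ => ((n : ℝ) + 1)⁻¹ * (‖f‖ + ‖f‖)) atTop (𝓝 0) := by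
            have h5 := tendsto_one_div_add_atTop_nhds_zero_nat (𝕜 := ℝ)
            simpa using h5.mul_const (‖f‖ + ‖f‖)
          refine squeeze_zero_norm (fun n => ?_) h4
          rw [norm_mul, Real.norm_of_nonneg (by positivity : (0 : ℝ) ≤ ((n : ℝ) + 1)⁻¹)]
          gcongr
          exact (abs_sub _ _).trans (add_le_add (hb _) (hb _))
        simp only [h2] at h1
        exact sub_eq_zero.1 (tendsto_nhds_unique h1 (h3.mono_left (Ultrafilter.of_le atTop)))
      · exact hμ.2 j hj
  obtain ⟨μ, hμ⟩ := IsCompact.nonempty_iInter_of_directed_nonempty_isCompact_isClosed D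
    (directed_of_isDirected_le fun F G (hFG : F ⊆ G) μ hμ => ⟨hμ.1, fun i hi => hμ.2 i (hFG hi)⟩)
    hDne (fun F => (hDclosed F).isCompact) hDclosed
  rw [mem_iInter] at hμ
  exact ⟨μ, (hμ ∅).1, fun i => (hμ {i}).2 i (by simp)⟩

end

end Exclusion

/-! ### The invariant coupling -/

namespace Exclusion

open Filter Topology BoundedContinuousFunction

section

variable {Ω : Type*} [MeasurableSpace Ω] {P : Measure Ω} [IsProbabilityMeasure P]
  {p : ℤ → ℤ → ℝ≥0} {N : ℤ → ℤ → ℝ≥0 → Ω → ℕ}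

theorem nuBar_map_fst (lam rho : ℝ) : (nuBar lam rho).map Prod.fst = bernoulliProduct rho := by
  rw [nuBar, Measure.map_map measurable_fst
    ((measurable_threshold rho).prodMk (measurable_threshold lam))]
  rfl

theorem nuBar_map_snd (lam rho : ℝ) : (nuBar lam rho).map Prod.snd = bernoulliProduct lam := by
  rw [nuBar, Measure.map_map measurable_snd
    ((measurable_threshold rho).prodMk (measurable_threshold lam))]
  rfl

instance (lam rho : ℝ) : IsProbabilityMeasure (nuBar lam rho) :=
  Measure.isProbabilityMeasure_map
    ((measurable_threshold rho).prodMk (measurable_threshold lam)).aemeasurable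

theorem isClosed_le_config : IsClosed {ζ : Config × Config | ζ.1 ≤ ζ.2} := by
  have : {ζ : Config × Config | ζ.1 ≤ ζ.2} = ⋂ x : ℤ, {ζ | ζ.1 x ≤ ζ.2 x} := by
    ext ζ
    simp only [mem_iInter, mem_ofPred_eq]
    rfl
  rw [this]
  refine isClosed_iInter fun x => ?_
  have hx : Continuous fun ζ : Config × Config => (ζ.1 x, ζ.2 x) := by fun_prop
  exact (isClosed_discrete {q : Bool × Bool | q.1 ≤ q.2}).preimage hx

theorem nuBar_le {lam rho : ℝ} (h : rho ≤ lam) : nuBar lam rho {ζ | ζ.1 ≤ ζ.2} = 1 := by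
  rw [nuBar, Measure.map_apply ((measurable_threshold rho).prodMk (measurable_threshold lam))
    isClosed_le_config.measurableSet]
  convert measure_univ (μ := Measure.infinitePi fun _ : ℤ => (volume : Measure unitInterval))
  refine eq_univ_of_forall fun U x => Bool.le_iff_imp.2 fun hx => ?_
  simp only [decide_eq_true_eq] at hx ⊢
  exact hx.trans h

/-- Two probability measures with the same first marginal can be realized jointly with equal first
components: given the first component, draw the second ones independently. -/
theorem exists_glued_measure {α β γ : Type*} [MeasurableSpace α] [StandardBorelSpace α]
    [MeasurableSpace β] [StandardBorelSpace β] [Nonempty β] [MeasurableSpace γ]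
    [StandardBorelSpace γ] [Nonempty γ] (μ : Measure (α × β)) (ν : Measure (α × γ))
    [IsProbabilityMeasure μ] [IsProbabilityMeasure ν] (h : μ.map Prod.fst = ν.map Prod.fst) :
    ∃ κ : Measure ((α × β) × (α × γ)), κ.map Prod.fst = μ ∧ κ.map Prod.snd = ν ∧
      κ {q | q.1.1 = q.2.1} = 1 := by
  have hg : Measurable fun q : α × (β × γ) => ((q.1, q.2.1), (q.1, q.2.2)) := by fun_prop
  have hμν : μ.fst = ν.fst := h
  refine ⟨(μ.fst ⊗ₘ (μ.condKernel ×ₖ ν.condKernel)).map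
    fun q : α × (β × γ) => ((q.1, q.2.1), (q.1, q.2.2)), ?_, ?_, ?_⟩
  · rw [Measure.map_map measurable_fst hg]
    change (μ.fst ⊗ₘ (μ.condKernel ×ₖ ν.condKernel)).map (Prod.map id Prod.fst) = μ
    rw [← Measure.compProd_map measurable_fst]
    rw [← Kernel.fst_eq, Kernel.fst_prod, μ.disintegrate μ.condKernel]
  · rw [Measure.map_map measurable_snd hg]
    change (μ.fst ⊗ₘ (μ.condKernel ×ₖ ν.condKernel)).map (Prod.map id Prod.snd) = ν
    rw [← Measure.compProd_map measurable_snd]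
    rw [← Kernel.snd_eq, Kernel.snd_prod, hμν, ν.disintegrate ν.condKernel]
  · rw [Measure.map_apply hg (measurableSet_eq_fun (by fun_prop) (by fun_prop))]
    simp

/-- The law of `(σ_t, θ_t)` when `(σ_0, θ_0)` has law `μ` and is independent of the Poisson
processes. -/
noncomputable def stepLaw (hp_transl : ∀ x y, p x y = p 0 (y - x))
    (hp_moment : Summable fun x : ℤ => |(x : ℝ)| * (p 0 x : ℝ))
    (hN : IsPoissonFamily P p N) (t : ℝ≥0) (μ : ProbabilityMeasure (Config × Config)) :
    ProbabilityMeasure (Config × Config) :=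
  ⟨((μ : Measure (Config × Config)).prod P).map fun q => coupled N t q.1 q.2,
    Measure.isProbabilityMeasure_map (aemeasurable_coupled hp_transl hp_moment hN t
      measurable_fst Measure.quasiMeasurePreserving_snd)⟩

theorem integral_stepLaw (hp_transl : ∀ x y, p x y = p 0 (y - x))
    (hp_moment : Summable fun x : ℤ => |(x : ℝ)| * (p 0 x : ℝ))
    (hN : IsPoissonFamily P p N) (t : ℝ≥0) (μ : ProbabilityMeasure (Config × Config))
    (f : Config × Config →ᵇ ℝ) :
    ∫ ζ, f ζ ∂(stepLaw hp_transl hp_moment hN t μ : Measure (Config × Config)) =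
      ∫ ζ, transOp hp_transl hp_moment hN t f ζ ∂(μ : Measure (Config × Config)) := by
  have hm := aemeasurable_coupled hp_transl hp_moment hN t
    (m := (μ : Measure (Config × Config)).prod P)
    measurable_fst Measure.quasiMeasurePreserving_snd
  have hf := (f.continuous.measurable.comp_aemeasurable hm).aestronglyMeasurable
  change ∫ ζ, f ζ ∂(((μ : Measure (Config × Config)).prod P).map _) = _
  rw [integral_map hm f.continuous.measurable.aestronglyMeasurable]
  exact integral_prod (fun q : (Config × Config) × Ω => f (coupled N t q.1 q.2))
    (Integrable.of_bound hf ‖f‖ (Eventually.of_forall fun q => f.norm_coe_le_norm _))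

/-- The couplings of the Bernoulli product measures of densities `rho` and `lam` that are supported
on ordered pairs if `rho < lam`. The marginals are prescribed through integrals of continuous
functions. -/
def couplings (lam rho : ℝ) : Set (ProbabilityMeasure (Config × Config)) :=
  {μ | (∀ f : Config →ᵇ ℝ,
      ∫ ζ, f ζ.1 ∂(μ : Measure (Config × Config)) = ∫ η, f η ∂(bernoulliProduct rho)) ∧
    (∀ f : Config →ᵇ ℝ,
      ∫ ζ, f ζ.2 ∂(μ : Measure (Config × Config)) = ∫ η, f η ∂(bernoulliProduct lam)) ∧
    (rho < lam → (μ : Measure (Config × Config)) {ζ | ζ.1 ≤ ζ.2} = 1)}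

theorem map_eq_bernoulliProduct {μ : ProbabilityMeasure (Config × Config)}
    {g : Config × Config → Config} (hg : Measurable g) {ρ : ℝ}
    (h : ∀ f : Config →ᵇ ℝ,
      ∫ ζ, f (g ζ) ∂(μ : Measure (Config × Config)) = ∫ η, f η ∂(bernoulliProduct ρ)) :
    (μ : Measure (Config × Config)).map g = bernoulliProduct ρ := by
  have := Measure.isProbabilityMeasure_map (μ := (μ : Measure (Config × Config))) hg.aemeasurable
  refine ext_of_forall_integral_eq_of_IsFiniteMeasure fun f => ?_
  rw [integral_map hg.aemeasurable f.continuous.measurable.aestronglyMeasurable, h]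

theorem map_apply_cylinder {μ : ProbabilityMeasure (Config × Config)}
    {g : Config × Config → Config} (hg : Measurable g) {ρ : ℝ} (hρ : ρ ∈ Icc (0 : ℝ) 1)
    (h : ∀ f : Config →ᵇ ℝ,
      ∫ ζ, f (g ζ) ∂(μ : Measure (Config × Config)) = ∫ η, f η ∂(bernoulliProduct ρ))
    (A : Finset ℤ) :
    (μ : Measure (Config × Config)) {ζ | ∀ x ∈ A, g ζ x = true} = ENNReal.ofReal (ρ ^ A.card) := by
  have hA : MeasurableSet {η : Config | ∀ x ∈ A, η x = true} := by
    have : {η : Config | ∀ x ∈ A, η x = true} = ⋂ x ∈ A, (fun η : Config => η x) ⁻¹' {true} := by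
      ext η; simp
    rw [this]
    exact A.measurableSet_biInter fun x _ => measurable_pi_apply x (measurableSet_singleton _)
  rw [← bernoulliProduct_cylinder hρ A, ← map_eq_bernoulliProduct hg h, Measure.map_apply hg hA]
  rfl

theorem isClosed_couplings (lam rho : ℝ) : IsClosed (couplings lam rho) := by
  have hmarg : ∀ (f : Config →ᵇ ℝ) (g : C(Config × Config, Config)) (c : ℝ), IsClosed
      {μ : ProbabilityMeasure (Config × Config) |
        ∫ ζ, f (g ζ) ∂(μ : Measure (Config × Config)) = c} := fun f g c =>
    isClosed_singleton.preimage
      (ProbabilityMeasure.continuous_integral_boundedContinuousFunction (f.compContinuous g))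
  have hle : IsClosed {μ : ProbabilityMeasure (Config × Config) |
      (μ : Measure (Config × Config)) {ζ | ζ.1 ≤ ζ.2} = 1} := by
    refine isClosed_iff_ultrafilter.2 fun μ U hU hmem => ?_
    refine le_antisymm prob_le_one ?_
    have h1 := ProbabilityMeasure.limsup_measure_closed_le_of_tendsto (μs := id)
      (L := (U : Filter _)) (tendsto_id'.2 hU) isClosed_le_config
    exact ((limsup_const (1 : ℝ≥0∞)).symm.trans
      (limsup_congr (EventuallyEq.symm hmem))).le.trans h1
  have : couplings lam rho = (⋂ f : Config →ᵇ ℝ, {μ : ProbabilityMeasure (Config × Config) |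
        ∫ ζ, f ζ.1 ∂(μ : Measure (Config × Config)) =
        ∫ η, f η ∂(bernoulliProduct rho)}) ∩
      ((⋂ f : Config →ᵇ ℝ, {μ : ProbabilityMeasure (Config × Config) |
        ∫ ζ, f ζ.2 ∂(μ : Measure (Config × Config)) =
        ∫ η, f η ∂(bernoulliProduct lam)}) ∩
      ⋂ _ : rho < lam, {μ : ProbabilityMeasure (Config × Config) |
        (μ : Measure (Config × Config)) {ζ | ζ.1 ≤ ζ.2} = 1}) := by
    ext μ
    simp only [couplings, mem_inter_iff, mem_iInter, mem_ofPred_eq]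
  rw [this]
  exact (isClosed_iInter fun f => hmarg f ContinuousMap.fst _).inter
    ((isClosed_iInter fun f => hmarg f ContinuousMap.snd _).inter (isClosed_iInter fun _ => hle))

theorem nuBar_mem_couplings (lam rho : ℝ) :
    (⟨nuBar lam rho, inferInstance⟩ : ProbabilityMeasure (Config × Config)) ∈
      couplings lam rho := by
  refine ⟨fun f => ?_, fun f => ?_, fun h => nuBar_le h.le⟩
  · rw [← nuBar_map_fst lam rho, integral_map measurable_fst.aemeasurable
      f.continuous.measurable.aestronglyMeasurable]
    rfl
  · rw [← nuBar_map_snd lam rho, integral_map measurable_snd.aemeasurable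
      f.continuous.measurable.aestronglyMeasurable]
    rfl

theorem averageMeasure_mem_couplings {lam rho : ℝ} {μ : ℕ → ProbabilityMeasure (Config × Config)}
    (h : ∀ k, μ k ∈ couplings lam rho) (n : ℕ) : averageMeasure μ n ∈ couplings lam rho := by
  have hmarg : ∀ (f : Config × Config →ᵇ ℝ) (c : ℝ),
      (∀ k, ∫ ζ, f ζ ∂(μ k : Measure (Config × Config)) = c) →
      ∫ ζ, f ζ ∂(averageMeasure μ n : Measure (Config × Config)) = c := by
    intro f c hc
    rw [integral_averageMeasure, Finset.sum_congr rfl fun k _ => hc k, Finset.sum_const,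
      Finset.card_range, nsmul_eq_mul, Nat.cast_add_one, inv_mul_cancel_left₀ (by positivity)]
  exact ⟨fun f => hmarg (f.compContinuous ContinuousMap.fst) _ fun k => (h k).1 f,
    fun f => hmarg (f.compContinuous ContinuousMap.snd) _ fun k => (h k).2.1 f,
    fun hlt => averageMeasure_apply_eq (fun k => (h k).2.2 hlt) n⟩

/-- The dynamics preserves the set of couplings: Bernoulli product measures are invariant for each
component, and the order is preserved because the components use the same jump attempts. -/
theorem stepLaw_mem_couplings (hp_transl : ∀ x y, p x y = p 0 (y - x))
    (hp_moment : Summable fun x : ℤ => |(x : ℝ)| * (p 0 x : ℝ))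
    (hN : IsPoissonFamily P p N) (t : ℝ≥0) {lam rho : ℝ}
    {μ : ProbabilityMeasure (Config × Config)} (hμ : μ ∈ couplings lam rho) :
    stepLaw hp_transl hp_moment hN t μ ∈ couplings lam rho := by
  have hmarg : ∀ (f : Config →ᵇ ℝ) (ρ : ℝ) (g : C(Config × Config, Config)),
      (∀ ζ ω, g (coupled N t ζ ω) = evolve (fun x y s => N x y s ω) t (g ζ)) →
      (∀ f : Config →ᵇ ℝ,
        ∫ ζ, f (g ζ) ∂(μ : Measure (Config × Config)) = ∫ η, f η ∂(bernoulliProduct ρ)) →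
      ∫ ζ, f (g ζ) ∂(stepLaw hp_transl hp_moment hN t μ : Measure (Config × Config)) =
        ∫ η, f η ∂(bernoulliProduct ρ) := by
    intro f ρ g hg h
    have h1 := integral_stepLaw hp_transl hp_moment hN t μ (f.compContinuous g)
    rw [← integral_evolve_bernoulliProduct hp_transl hp_moment hN t ρ f]
    refine h1.trans ?_
    have h2 := h (BoundedContinuousFunction.mkOfCompact
      ⟨_, continuous_integral_evolve hp_transl hp_moment hN t f⟩)
    simp only [transOp_apply, BoundedContinuousFunction.compContinuous_apply, hg]
    exact h2
  refine ⟨fun f => hmarg f rho ContinuousMap.fst (fun _ _ => rfl) hμ.1,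
    fun f => hmarg f lam ContinuousMap.snd (fun _ _ => rfl) hμ.2.1, fun hlt => ?_⟩
  have hm := aemeasurable_coupled hp_transl hp_moment hN t
    (m := (μ : Measure (Config × Config)).prod P)
    measurable_fst Measure.quasiMeasurePreserving_snd
  change ((μ : Measure (Config × Config)).prod P).map (fun q => coupled N t q.1 q.2) _ = 1
  rw [Measure.map_apply_of_aemeasurable hm isClosed_le_config.measurableSet]
  refine le_antisymm prob_le_one ?_
  calc (1 : ℝ≥0∞) = (μ : Measure (Config × Config)).prod P ({ζ | ζ.1 ≤ ζ.2} ×ˢ univ) := by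
        rw [Measure.prod_prod, hμ.2.2 hlt, measure_univ, one_mul]
    _ ≤ _ := measure_mono fun q hq => monotone_evolve _ t hq.1

end

end Exclusion

theorem lemma2p1 {Ω : Type*} [MeasurableSpace Ω] (P : Measure Ω) [IsProbabilityMeasure P]
    (p : ℤ → ℤ → ℝ≥0)
    (hp_sum : ∀ x, HasSum (p x) 1)
    (hp_transl : ∀ x y, p x y = p 0 (y - x))
    (hp_moment : Summable fun x : ℤ => |(x : ℝ)| * (p 0 x : ℝ))
    (N : ℤ → ℤ → ℝ≥0 → Ω → ℕ) (hN : Exclusion.IsPoissonFamily P p N)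
    (lam rho : ℝ) (hlam : lam ∈ Set.Icc (0 : ℝ) 1) (hrho : rho ∈ Set.Icc (0 : ℝ) 1) :
    ∃ μ : Measure (Exclusion.Config × Exclusion.Config),
      IsProbabilityMeasure μ ∧
      Exclusion.IsInvariant P N μ ∧
      (∀ A : Finset ℤ, μ {ζ | ∀ x ∈ A, ζ.1 x = true} = ENNReal.ofReal (rho ^ A.card)) ∧
      (∀ A : Finset ℤ, μ {ζ | ∀ x ∈ A, ζ.2 x = true} = ENNReal.ofReal (lam ^ A.card)) ∧
      (rho < lam → μ {ζ | ζ.1 ≤ ζ.2} = 1) ∧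
      ∃ νν : Measure ((Exclusion.Config × Exclusion.Config) ×
          (Exclusion.Config × Exclusion.Config)),
        νν.map Prod.fst = μ ∧
        νν.map Prod.snd = Exclusion.nuBar lam rho ∧
        νν {q | q.1.1 = q.2.1} = 1 := by
  obtain ⟨μ, hμ, hinv⟩ := Exclusion.exists_common_invariant
    (Exclusion.stepLaw hp_transl hp_moment hN) (Exclusion.transOp hp_transl hp_moment hN)
    (Exclusion.integral_stepLaw hp_transl hp_moment hN)
    (fun s t f => by
      rw [← Exclusion.transOp_add, add_comm, Exclusion.transOp_add])
    (Exclusion.isClosed_couplings lam rho) ⟨_, Exclusion.nuBar_mem_couplings lam rho⟩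
    (fun t μ hμ => Exclusion.stepLaw_mem_couplings hp_transl hp_moment hN t hμ)
    (fun ν hν n => Exclusion.averageMeasure_mem_couplings hν n)
  refine ⟨μ, inferInstance, fun t => ⟨Exclusion.aemeasurable_coupled hp_transl hp_moment hN t
    measurable_fst Measure.quasiMeasurePreserving_snd, congrArg Subtype.val (hinv t)⟩,
    Exclusion.map_apply_cylinder measurable_fst hrho hμ.1,
    Exclusion.map_apply_cylinder measurable_snd hlam hμ.2.1, hμ.2.2,
    Exclusion.exists_glued_measure _ _ ?_⟩
  rw [Exclusion.map_eq_bernoulliProduct measurable_fst hμ.1, Exclusion.nuBar_map_fst]
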